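/- Let $n\ge 3$, $m\ge 1$, $\nu\in(0,1]$, and let $\Omega\subset\mathbb R^n$ be a (possibly unbounded) domain. Let $A^{\alpha\beta}_{ij}$ ($1\le\alpha,\beta\le n$, $1\le i,j\le m$) be measurable functions on $\mathbb R^n$ such that for all $x\in\mathbb R^n$ and $\xi=(\xi^i_\alpha)\in\mathbb R^{mn}$ \[ \sum_{i,j,\alpha,\beta}A^{\alpha\beta}_{ij}(x)\,\xi^j_\beta\,\xi^i_\alpha\ \ge\ \nu\sum_{i,\alpha}|\xi^i_\alpha|^2,\qquad \sum_{i,j,\alpha,\beta}|A^{\alpha\beta}_{ij}(x)|^2\le\nu^{-2}. \] For $u=(u^1,\dots,u^m)$ put $(Lu)^i=-\sum_{j,\alpha,\beta}D_\alpha(A^{\alpha\beta}_{ij}D_\beta u^j)$, and let ${}^tL$ be the adjoint operator, whose coefficients are ${}^tA^{\alpha\beta}_{ij}=A^{\beta\alpha}_{ji}$. Weak solutions are understood by testing with $C_c^\infty$ functions. Write $\Omega_R(x)=\Omega\cap B_R(x)$ and $\Sigma_R(x)=\partial\Omega\cap B_R(x)$. For an open set $U$, $Y^{1,2}(U)$ is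 the space of weakly differentiable $u\in L^{2n/(n-2)}(U)$ with $Du\in L^2(U)$, normed by $\|u\|_{L^{2n/(n-2)}(U)}+\|Du\|_{L^2(U)}$. A function $u\in Y^{1,2}(U)$ vanishes on $\Sigma\subset\overline U$ if it is a limit in $Y^{1,2}(U)$ of a sequence in $C_c^\infty(\overline U\setminus\Sigma)$, the restrictions to $\overline U$ of smooth functions on $\mathbb R^n$ that vanish on $\overline U$ outside a compact subset of $\overline U\setminus\Sigma$. Below this is applied with $U=\Omega_R(x)$, $\Sigma=\Sigma_R(x)$. Condition (LH), with constants $\mu_0\in(0,1]$, $R_{max}\in(0,\infty]$, $N_1>0$: for all $x\in\Omega$ and $R\in(0,R_{max})$, if $u\in W^{1,2}(\Omega_R(x))$ is a weak solution of $Lu=0$ or of ${}^tLu=0$ in $\Omega_R(x)$ and vanishes on $\Sigma_R(x)$, then \[ \int_{\Omega_r(x)}|Du|^2\le N_1\Big(\frac rs\Big)^{n-2+2\mu_0}\int_{\Omega_s(x)}|Du|^2\qquad\text{for }0<r<s\le R. \] Condition (LB), with constants $R_{max}\in(0,\infty]$, $N_0>0$: for all $x\in\Omega$, $R\in(0,R_{max})$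 and $f\in L^\infty(\Omega_R(x))$, if $u\in W^{1,2}(\Omega_R(x))$ is a weak solution of $Lu=f$ or of ${}^tLu=f$ in $\Omega_R(x)$ and vanishes on $\Sigma_R(x)$, then \[ \|u\|_{L^\infty(\Omega_{R/2}(x))}\le N_0\left(R^{-n/2}\|u\|_{L^2(\Omega_R(x))}+R^2\|f\|_{L^\infty(\Omega_R(x))}\right). \] Lemma. Assume (LH) with constants $\mu_0,R_{max},N_1$. For every $p\in(n/2,\infty]$ there is a constant $C=C(n,m,\nu,\mu_0,N_1,p)$ such that for all $x\in\Omega$, $R\in(0,R_{max})$ and $f\in L^p(\Omega_R(x))$ the following holds: if $u\in W^{1,2}(\Omega_R(x))$ is a weak solution of $Lu=f$ or of ${}^tLu=f$ in $\Omega_R(x)$ and vanishes on $\Sigma_R(x)$, then \[ \|u\|_{L^\infty(\Omega_{R/2}(x))}\le C\left(R^{-n/2}\|u\|_{L^2(\Omega_R(x))}+R^{2-n/p}\|f\|_{L^p(\Omega_R(x))}\right), \] where $n/\infty=0$. In particular (LB) holds with the same $R_{max}$ and with $N_0=N_0(n,m,\nu,\mu_0,N_1)$. -/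

import Mathlib

open MeasureTheory Filter Topology
open scoped ENNReal ContDiff

namespace EllipticSystem

/-- Points of `ℝⁿ`, with the Euclidean norm. -/
abbrev Pt (n : ℕ) := EuclideanSpace ℝ (Fin n)

/-- Values of vector functions `u = (u¹, …, uᵐ)`, with the Euclidean norm. -/
abbrev Vec (m : ℕ) := EuclideanSpace ℝ (Fin m)

/-- Values of gradients: the entry `(i, α)` stands for `D_α uⁱ`. The norm is
`|Du| = (∑ i α, |D_α uⁱ|²)^(1/2)`. -/
abbrev Grad (m n : ℕ) := EuclideanSpace ℝ (Fin m × Fin n)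

/-- Coefficients of a system: `A x α β i j` is `A^{αβ}_{ij}(x)`. -/
abbrev Coeff (m n : ℕ) := Pt n → Fin n → Fin n → Fin m → Fin m → ℝ

/-- Measurable coefficients on `ℝⁿ`, strongly elliptic and bounded with constant `ν`. -/
structure IsElliptic {m n : ℕ} (ν : ℝ) (A : Coeff m n) : Prop where
  measurable : ∀ α β i j, Measurable fun x => A x α β i j
  elliptic : ∀ (x : Pt n) (ξ : Fin m → Fin n → ℝ),
    ν * ∑ i, ∑ α, (ξ i α) ^ 2 ≤ ∑ i, ∑ j, ∑ α, ∑ β, A x α β i j * ξ j β * ξ i α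
  bounded : ∀ x : Pt n, ∑ i, ∑ j, ∑ α, ∑ β, (A x α β i j) ^ 2 ≤ (ν ^ 2)⁻¹

/-- Coefficients of the adjoint operator: `ᵗA^{αβ}_{ij} = A^{βα}_{ji}`. -/
def adj {m n : ℕ} (A : Coeff m n) : Coeff m n := fun x α β i j => A x β α j i

/-- `φ ∈ C_c^∞(U)`. -/
def IsTest {n : ℕ} {F : Type*} [NormedAddCommGroup F] [NormedSpace ℝ F]
    (U : Set (Pt n)) (φ : Pt n → F) : Prop :=
  ContDiff ℝ ∞ φ ∧ HasCompactSupport φ ∧ tsupport φ ⊆ U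

/-- The classical gradient of a smooth vector function, `(i, α) ↦ D_α φⁱ`. -/
noncomputable def grad {m n : ℕ} (φ : Pt n → Vec m) : Pt n → Grad m n := fun x =>
  WithLp.toLp 2 fun q => (fderiv ℝ φ x (EuclideanSpace.single q.2 1)) q.1

/-- `g` is the weak gradient of `u` in the open set `U`. -/
def HasWeakGrad {m n : ℕ} (U : Set (Pt n)) (u : Pt n → Vec m) (g : Pt n → Grad m n) : Prop :=
  LocallyIntegrableOn u U ∧ LocallyIntegrableOn g U ∧
    ∀ φ : Pt n → ℝ, IsTest U φ → ∀ (i : Fin m) (α : Fin n),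
      ∫ x in U, u x i * fderiv ℝ φ x (EuclideanSpace.single α 1) = - ∫ x in U, g x (i, α) * φ x

/-- `u ∈ W^{1,2}(U)` with weak gradient `g`. -/
def MemW12 {m n : ℕ} (U : Set (Pt n)) (u : Pt n → Vec m) (g : Pt n → Grad m n) : Prop :=
  HasWeakGrad U u g ∧ MemLp u 2 (volume.restrict U) ∧ MemLp g 2 (volume.restrict U)

/-- The exponent `2n/(n-2)`, for `n ≥ 3`. -/
noncomputable def sobolevExp (n : ℕ) : ℝ≥0∞ := ENNReal.ofReal (2 * (n : ℝ) / ((n : ℝ) - 2))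

/-- `u ∈ Y^{1,2}(U)` with weak gradient `g`. -/
def MemY12 {m n : ℕ} (U : Set (Pt n)) (u : Pt n → Vec m) (g : Pt n → Grad m n) : Prop :=
  HasWeakGrad U u g ∧ MemLp u (sobolevExp n) (volume.restrict U) ∧ MemLp g 2 (volume.restrict U)

/-- The restriction of `φ` to the closure of `U` belongs to `C_c^∞(closure U \ S)`: it is the
restriction of a smooth function on `ℝⁿ` and vanishes outside a compact subset of
`closure U \ S`. -/
def IsTestOff {m n : ℕ} (U S : Set (Pt n)) (φ : Pt n → Vec m) : Prop :=
  ContDiff ℝ ∞ φ ∧ ∃ K : Set (Pt n), IsCompact K ∧ K ⊆ closure U \ S ∧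
    ∀ x ∈ closure U, x ∉ K → φ x = 0

/-- `u ∈ Y^{1,2}(U)`, with weak gradient `g`, vanishes on `S ⊆ closure U`: it is a limit in
`Y^{1,2}(U)` of a sequence in `C_c^∞(closure U \ S)`. -/
def VanishesOn {m n : ℕ} (U S : Set (Pt n)) (u : Pt n → Vec m) (g : Pt n → Grad m n) : Prop :=
  MemY12 U u g ∧ ∃ φ : ℕ → Pt n → Vec m, (∀ k, IsTestOff U S (φ k)) ∧
    Tendsto (fun k => eLpNorm (u - φ k) (sobolevExp n) (volume.restrict U)) atTop (𝓝 0) ∧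
    Tendsto (fun k => eLpNorm (g - grad (φ k)) 2 (volume.restrict U)) atTop (𝓝 0)

/-- A function with weak gradient `g` is a weak solution of `-D_α (A^{αβ} D_β u) = f` in `U`. -/
def IsWeakSol {m n : ℕ} (A : Coeff m n) (U : Set (Pt n)) (g : Pt n → Grad m n)
    (f : Pt n → Vec m) : Prop :=
  ∀ φ : Pt n → Vec m, IsTest U φ →
    ∫ x in U, ∑ i, ∑ j, ∑ α, ∑ β, A x α β i j * g x (j, β) * grad φ x (i, α) =
      ∫ x in U, ∑ i, f x i * φ x i

/-- `Ω_R(x) = Ω ∩ B_R(x)`. -/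
def localDomain {n : ℕ} (Ω : Set (Pt n)) (x : Pt n) (R : ℝ) : Set (Pt n) := Ω ∩ Metric.ball x R

/-- `Σ_R(x) = ∂Ω ∩ B_R(x)`. -/
def localBdry {n : ℕ} (Ω : Set (Pt n)) (x : Pt n) (R : ℝ) : Set (Pt n) :=
  frontier Ω ∩ Metric.ball x R

/-- `u ∈ W^{1,2}(Ω_R(x))`, with weak gradient `g`, is a weak solution of `L u = f` or of
`ᵗL u = f` in `Ω_R(x)` and vanishes on `Σ_R(x)`. -/
def IsLocalSol {m n : ℕ} (A : Coeff m n) (Ω : Set (Pt n)) (x : Pt n) (R : ℝ)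
    (u : Pt n → Vec m) (g : Pt n → Grad m n) (f : Pt n → Vec m) : Prop :=
  MemW12 (localDomain Ω x R) u g ∧
    (IsWeakSol A (localDomain Ω x R) g f ∨ IsWeakSol (adj A) (localDomain Ω x R) g f) ∧
    VanishesOn (localDomain Ω x R) (localBdry Ω x R) u g

/-- The condition (LH) with the constants `μ₀`, `Rmax`, `N₁`. -/
def CondLH {m n : ℕ} (A : Coeff m n) (Ω : Set (Pt n)) (μ₀ : ℝ) (Rmax : ℝ≥0∞) (N₁ : ℝ) : Prop :=
  ∀ x ∈ Ω, ∀ R : ℝ, 0 < R → ENNReal.ofReal R < Rmax →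
    ∀ (u : Pt n → Vec m) (g : Pt n → Grad m n), IsLocalSol A Ω x R u g 0 →
      ∀ r s : ℝ, 0 < r → r < s → s ≤ R →
        ∫ y in localDomain Ω x r, ‖g y‖ ^ 2 ≤
          N₁ * (r / s) ^ ((n : ℝ) - 2 + 2 * μ₀) * ∫ y in localDomain Ω x s, ‖g y‖ ^ 2

/-- The condition (LB) with the constants `Rmax`, `N₀`. -/
def CondLB {m n : ℕ} (A : Coeff m n) (Ω : Set (Pt n)) (Rmax : ℝ≥0∞) (N₀ : ℝ) : Prop :=
  ∀ x ∈ Ω, ∀ R : ℝ, 0 < R → ENNReal.ofReal R < Rmax →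
    ∀ f : Pt n → Vec m, MemLp f ∞ (volume.restrict (localDomain Ω x R)) →
      ∀ (u : Pt n → Vec m) (g : Pt n → Grad m n), IsLocalSol A Ω x R u g f →
        eLpNorm u ∞ (volume.restrict (localDomain Ω x (R / 2))) ≤
          ENNReal.ofReal N₀ *
            (ENNReal.ofReal (R ^ (-(n : ℝ) / 2)) *
                eLpNorm u 2 (volume.restrict (localDomain Ω x R)) +
              ENNReal.ofReal (R ^ 2) * eLpNorm f ∞ (volume.restrict (localDomain Ω x R)))

end EllipticSystem

open EllipticSystem

/-! The bound is proved pointwise by Morrey's method. Put `δ = 2 - n/p > 0` and fix `y ∈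
Ω_{R/2}(x)`, `s ≤ R/4`. On `Ω_s(y)` let `w` solve the same system with zero boundary values. Testing
with `w` and Sobolev's inequality give `‖Dw‖₂ ≤ C ‖f‖_{2n/(n+2)}`, which Hölder's inequality turns
into `C s^(n/2-1+δ) ‖f‖_p`. The remainder `u - w` solves the homogeneous system and vanishes on
`Σ_s(y)`, so (LH) shrinks its Dirichlet norm by `√N₁ θ^(n/2-1+μ₀)` from radius `s` to `θs`. This is
one step of decay for `Du` (`CondLH.lpNorm_le`). With `0 < γ < μ₀`, `γ ≤ δ` and `θ` small enough to
absorb `N₁`, iteration shows that the `L²` norm of `Du` on `Ω_{θ^k R/4}(y)` decays like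
`θ^(k(n/2-1+γ))`.

Decay of the gradient controls `u` through averages. Because `u` vanishes on `Σ_R(x)`, the cut-off
`ηu` is a limit of test functions of `Ω_R(x)` (`VanishesOn.cutoff`). Its extension by zero can
therefore be treated on whole balls, near the boundary as in the interior, and no regularity of `∂Ω`
is needed. Averages of it over concentric balls of radii `r` and `θr` differ by at most `C
r^(1-n/2)` times the `L²` norm of the gradient on the larger ball (`IsY0.norm_setAverage_sub_le`).
Along `r = θ^k R/4` these differences are bounded by a geometric sequence of ratio `θ^γ`, and by
Lebesgue's theorem the averages converge to `u(y)` for almost every `y`.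

The start of the iteration is controlled as well: the first average is at most `C R^(-n/2) ‖u‖₂`,
and the first Dirichlet norm is bounded by Caccioppoli's inequality (`VanishesOn.caccioppoli`). The
sum is carried out in `norm_le_of_average_decay`, and `exists_ae_norm_le` assembles the estimate. -/

namespace EllipticSystem

/-! ### Real-valued `L^p` norms and Hölder's inequality. -/

section LpTools

variable {X E F : Type*} [MeasurableSpace X] [NormedAddCommGroup E] [NormedAddCommGroup F]
  {μ : Measure X}

theorem lpNorm_le_of_eLpNorm_le {f : X → E} {g : X → F} {p q : ℝ≥0∞} {μ' : Measure X} {C : ℝ}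
    (hC : 0 ≤ C) (hf : MemLp f p μ) (hg : MemLp g q μ')
    (h : eLpNorm f p μ ≤ ENNReal.ofReal C * eLpNorm g q μ') :
    lpNorm f p μ ≤ C * lpNorm g q μ' := by
  rw [← ofReal_lpNorm hf, ← ofReal_lpNorm hg, ← ENNReal.ofReal_mul hC] at h
  exact (ENNReal.ofReal_le_ofReal_iff (mul_nonneg hC lpNorm_nonneg)).1 h

/-- Only the dominating function has to be in `L^p`, since `lpNorm` is `0` by convention outside
`L^p`. -/
theorem lpNorm_le_mul_of_ae_le {f : X → E} {g : X → F} {p : ℝ≥0∞} {C : ℝ} (hC : 0 ≤ C)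
    (hg : MemLp g p μ) (h : ∀ᵐ x ∂μ, ‖f x‖ ≤ C * ‖g x‖) :
    lpNorm f p μ ≤ C * lpNorm g p μ := by
  by_cases hf : MemLp f p μ
  · exact lpNorm_le_of_eLpNorm_le hC hf hg (eLpNorm_le_mul_eLpNorm_of_ae_le_mul h p)
  · rw [lpNorm_of_not_memLp hf]
    exact mul_nonneg hC lpNorm_nonneg

theorem lpNorm_mono_ae {f : X → E} {g : X → F} {p : ℝ≥0∞}
    (hg : MemLp g p μ) (h : ∀ᵐ x ∂μ, ‖f x‖ ≤ ‖g x‖) : lpNorm f p μ ≤ lpNorm g p μ := by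
  simpa using lpNorm_le_mul_of_ae_le zero_le_one hg (by simpa using h)

theorem lpNorm_congr_ae {f g : X → E} {p : ℝ≥0∞} (h : f =ᵐ[μ] g) :
    lpNorm f p μ = lpNorm g p μ := by
  by_cases hf : MemLp f p μ
  · exact le_antisymm
      (lpNorm_mono_ae ((memLp_congr_ae h).1 hf) (h.mono fun x hx => by rw [hx]))
      (lpNorm_mono_ae hf (h.mono fun x hx => by rw [hx]))
  · rw [lpNorm_of_not_memLp hf, lpNorm_of_not_memLp (fun h' => hf ((memLp_congr_ae h).2 h'))]

theorem lpNorm_mono_measure {f : X → E} {p : ℝ≥0∞} {μ' : Measure X} (h : μ ≤ μ')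
    (hf : MemLp f p μ') : lpNorm f p μ ≤ lpNorm f p μ' := by
  simpa using lpNorm_le_of_eLpNorm_le zero_le_one (hf.mono_measure h) hf
    (by simpa using eLpNorm_mono_measure f h)

theorem lpNorm_mono_set {f : X → E} {p : ℝ≥0∞} {s t : Set X} (h : s ⊆ t)
    (hf : MemLp f p (μ.restrict t)) : lpNorm f p (μ.restrict s) ≤ lpNorm f p (μ.restrict t) :=
  lpNorm_mono_measure (Measure.restrict_mono_set μ h) hf

theorem MemLp.mono_set {f : X → E} {p : ℝ≥0∞} {s t : Set X} (h : s ⊆ t)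
    (hf : MemLp f p (μ.restrict t)) : MemLp f p (μ.restrict s) :=
  hf.mono_measure (Measure.restrict_mono_set μ h)

/-- Hölder's inequality for a function bounded by a product of norms. -/
theorem integrable_and_abs_integral_le {f : X → E} {g : X → F} {k : X → ℝ} {p q : ℝ≥0∞}
    [hpq : p.HolderConjugate q] {C : ℝ} (hC : 0 ≤ C) (hf : MemLp f p μ) (hg : MemLp g q μ)
    (hk : AEStronglyMeasurable k μ) (h : ∀ᵐ x ∂μ, |k x| ≤ C * ‖f x‖ * ‖g x‖) :
    Integrable k μ ∧ |∫ x, k x ∂μ| ≤ C * lpNorm f p μ * lpNorm g q μ := by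
  have h1 : eLpNorm k 1 μ ≤ ENNReal.ofReal (C * lpNorm f p μ * lpNorm g q μ) := by
    have h2 := eLpNorm_le_eLpNorm_mul_eLpNorm'_of_norm (μ := μ) (p := p) (q := q) (r := 1)
      hf.1 hg.1 (fun a b => C * ‖a‖ * ‖b‖) ⟨C, hC⟩
      (Eventually.of_forall fun x => by
        rw [Real.norm_eq_abs, abs_of_nonneg (by positivity)]
        rfl)
    have h3 : eLpNorm k 1 μ ≤ eLpNorm (fun x => C * ‖f x‖ * ‖g x‖) 1 μ :=
      eLpNorm_mono_ae (h.mono fun x hx => by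
        rw [Real.norm_eq_abs]; exact hx.trans (le_abs_self _))
    refine (h3.trans h2).trans (le_of_eq ?_)
    rw [ENNReal.ofReal_mul (mul_nonneg hC lpNorm_nonneg), ENNReal.ofReal_mul hC,
      ofReal_lpNorm hf, ofReal_lpNorm hg, ENNReal.ofReal_eq_coe_nnreal hC]
    rfl
  have hm : MemLp k 1 μ := ⟨hk, h1.trans_lt ENNReal.ofReal_lt_top⟩
  refine ⟨memLp_one_iff_integrable.1 hm, ?_⟩
  have h4 : lpNorm k 1 μ ≤ C * lpNorm f p μ * lpNorm g q μ := by
    rw [← ofReal_lpNorm hm] at h1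
    exact (ENNReal.ofReal_le_ofReal_iff
      (mul_nonneg (mul_nonneg hC lpNorm_nonneg) lpNorm_nonneg)).1 h1
  rw [lpNorm_one_eq_integral_norm hk] at h4
  exact (norm_integral_le_integral_norm k).trans h4

theorem tendsto_lpNorm_of_tendsto_sub {f : X → E} {φ : ℕ → X → E} {p : ℝ≥0∞} (hp : 1 ≤ p)
    (hf : MemLp f p μ) (hφ : ∀ k, MemLp (φ k) p μ)
    (h : Tendsto (fun k => lpNorm (f - φ k) p μ) atTop (𝓝 0)) :
    Tendsto (fun k => lpNorm (φ k) p μ) atTop (𝓝 (lpNorm f p μ)) := by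
  rw [tendsto_iff_norm_sub_tendsto_zero]
  refine squeeze_zero (fun k => norm_nonneg _) (fun k => ?_) h
  rw [Real.norm_eq_abs, abs_sub_le_iff]
  constructor
  · have := lpNorm_le_lpNorm_add_lpNorm_sub hf hp (f := φ k)
    linarith
  · have := lpNorm_le_lpNorm_add_lpNorm_sub (hφ k) hp (f := f)
    linarith [lpNorm_sub_comm f (φ k) p μ]

theorem tendsto_lpNorm_iff {f : X → E} {φ : ℕ → X → E} {p : ℝ≥0∞}
    (hf : MemLp f p μ) (hφ : ∀ k, MemLp (φ k) p μ) :
    Tendsto (fun k => lpNorm (f - φ k) p μ) atTop (𝓝 0) ↔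
      Tendsto (fun k => eLpNorm (f - φ k) p μ) atTop (𝓝 0) := by
  have : (fun k => lpNorm (f - φ k) p μ) = fun k => (eLpNorm (f - φ k) p μ).toReal :=
    funext fun k => (toReal_eLpNorm (hf.sub (hφ k)).1).symm
  rw [this, ENNReal.tendsto_toReal_zero_iff fun k => (hf.sub (hφ k)).2.ne]

theorem lpNorm_sq_eq_integral {f : X → E} (hf : AEStronglyMeasurable f μ) :
    lpNorm f 2 μ ^ 2 = ∫ x, ‖f x‖ ^ 2 ∂μ := by
  rw [lpNorm_eq_integral_norm_rpow_toReal (by norm_num) (by norm_num) hf]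
  simp only [ENNReal.toReal_ofNat, Real.rpow_two]
  rw [← Real.rpow_natCast, ← Real.rpow_mul (integral_nonneg fun x => by positivity)]
  norm_num

theorem lpNorm_le_mul_measure_rpow {f : X → E} {p q : ℝ≥0∞} [IsFiniteMeasure μ] (hpq : p ≤ q)
    (hf : MemLp f q μ) :
    lpNorm f p μ ≤ (μ.real Set.univ) ^ (p.toReal⁻¹ - q.toReal⁻¹) * lpNorm f q μ := by
  by_cases h0 : p = 0
  · subst h0
    simp only [lpNorm_exponent_zero]
    exact mul_nonneg (by positivity) lpNorm_nonneg
  have hexp : 0 ≤ p.toReal⁻¹ - q.toReal⁻¹ := by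
    rcases eq_or_ne q ∞ with rfl | hq
    · simp
    · have hp' := ne_top_of_le_ne_top hq hpq
      rw [sub_nonneg]
      exact inv_anti₀ (ENNReal.toReal_pos h0 hp') (ENNReal.toReal_mono hq hpq)
  refine lpNorm_le_of_eLpNorm_le (by positivity) (hf.mono_exponent hpq) hf ?_
  refine (eLpNorm_le_eLpNorm_mul_rpow_measure_univ hpq hf.1).trans (le_of_eq ?_)
  rw [mul_comm, one_div, one_div, ← ENNReal.ofReal_rpow_of_nonneg measureReal_nonneg hexp,
    ofReal_measureReal]

end LpTools

/-! ### The Sobolev exponent and its conjugate. -/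

section Exponents

variable {n : ℕ}

/-- The exponent `2n/(n+2)`, conjugate to `sobolevExp n`. -/
noncomputable def dualExp (n : ℕ) : ℝ≥0∞ := ENNReal.ofReal (2 * (n : ℝ) / ((n : ℝ) + 2))

theorem three_le_cast (hn : 3 ≤ n) : (3 : ℝ) ≤ n := by exact_mod_cast hn

theorem holderConjugate_dualExp (hn : 3 ≤ n) : (dualExp n).HolderConjugate (sobolevExp n) := by
  have h := three_le_cast hn
  constructor
  have h1 : 0 < 2 * (n : ℝ) / ((n : ℝ) + 2) := by positivity
  have h2 : 0 < 2 * (n : ℝ) / ((n : ℝ) - 2) := div_pos (by positivity) (by linarith)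
  rw [dualExp, sobolevExp, ← ENNReal.ofReal_inv_of_pos h1, ← ENNReal.ofReal_inv_of_pos h2,
    ← ENNReal.ofReal_add (by positivity) (by positivity), inv_one, ← ENNReal.ofReal_one]
  congr 1
  have : (n : ℝ) - 2 ≠ 0 := by linarith
  field_simp
  ring

theorem two_le_sobolevExp (hn : 3 ≤ n) : 2 ≤ sobolevExp n := by
  have h := three_le_cast hn
  rw [sobolevExp, ← ENNReal.ofReal_ofNat]
  refine ENNReal.ofReal_le_ofReal ?_
  rw [le_div_iff₀ (by linarith)]
  linarith

theorem one_le_sobolevExp (hn : 3 ≤ n) : 1 ≤ sobolevExp n :=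
  le_trans (by norm_num) (two_le_sobolevExp hn)

theorem toReal_sobolevExp_inv (hn : 3 ≤ n) : (sobolevExp n).toReal⁻¹ = 1 / 2 - 1 / (n : ℝ) := by
  have h := three_le_cast hn
  have h2 : (n : ℝ) - 2 ≠ 0 := by linarith
  rw [sobolevExp, ENNReal.toReal_ofReal (div_nonneg (by positivity) (by linarith))]
  field_simp

theorem toReal_dualExp_inv (hn : 3 ≤ n) : (dualExp n).toReal⁻¹ = 1 / 2 + 1 / (n : ℝ) := by
  have h := three_le_cast hn
  rw [dualExp, ENNReal.toReal_ofReal (by positivity)]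
  field_simp

/-- The inequality `2n/(n+2) ≤ n/2` amounts to `n ≥ 2`. On bounded sets it puts the right-hand side
`f` in the space that pairs with the Sobolev space. -/
theorem dualExp_le_of_lt (hn : 3 ≤ n) {p : ℝ≥0∞} (hp : (n : ℝ≥0∞) / 2 < p) : dualExp n ≤ p := by
  have h := three_le_cast hn
  refine le_trans ?_ hp.le
  have : (n : ℝ≥0∞) / 2 = ENNReal.ofReal ((n : ℝ) / 2) := by
    rw [ENNReal.ofReal_div_of_pos (by norm_num)]; simp
  rw [this, dualExp]
  refine ENNReal.ofReal_le_ofReal ?_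
  rw [div_le_div_iff₀ (by positivity) (by norm_num)]
  nlinarith

/-- This is the gain `δ = 2 - n/p` of the source term. Writing `1/p` as `(p⁻¹).toReal` makes `p = ∞`
give `δ = 2`. -/
theorem two_sub_pos_of_lt (hn : 3 ≤ n) {p : ℝ≥0∞} (hp : (n : ℝ≥0∞) / 2 < p) :
    0 < 2 - (n : ℝ) * (p⁻¹).toReal := by
  have h := three_le_cast hn
  rcases eq_or_ne p ∞ with rfl | hp'
  · simp
  have h1 : (n : ℝ) / 2 < p.toReal := by
    have := (ENNReal.toReal_lt_toReal (by finiteness) hp').2 hp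
    simpa using this
  rw [ENNReal.toReal_inv, sub_pos, ← div_eq_mul_inv, div_lt_iff₀ (by linarith)]
  linarith

end Exponents

/-! ### The bilinear form of the system. -/

section Energy

variable {m n : ℕ}

/-- The bilinear form `∑ A^{αβ}_{ij}(x) G^j_β H^i_α`. -/
def energy (A : Coeff m n) (x : Pt n) (G H : Grad m n) : ℝ :=
  ∑ i, ∑ j, ∑ α, ∑ β, A x α β i j * G (j, β) * H (i, α)

theorem energy_add_left (A : Coeff m n) (x : Pt n) (G G' H : Grad m n) :
    energy A x (G + G') H = energy A x G H + energy A x G' H := by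
  simp only [energy, PiLp.add_apply, mul_add, add_mul, Finset.sum_add_distrib]

theorem energy_add_right (A : Coeff m n) (x : Pt n) (G H H' : Grad m n) :
    energy A x G (H + H') = energy A x G H + energy A x G H' := by
  simp only [energy, PiLp.add_apply, mul_add, Finset.sum_add_distrib]

theorem energy_smul_left (A : Coeff m n) (x : Pt n) (c : ℝ) (G H : Grad m n) :
    energy A x (c • G) H = c * energy A x G H := by
  simp only [energy, PiLp.smul_apply, smul_eq_mul, Finset.mul_sum]
  refine Finset.sum_congr rfl fun i _ => Finset.sum_congr rfl fun j _ =>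
    Finset.sum_congr rfl fun α _ => Finset.sum_congr rfl fun β _ => by ring

theorem energy_smul_right (A : Coeff m n) (x : Pt n) (c : ℝ) (G H : Grad m n) :
    energy A x G (c • H) = c * energy A x G H := by
  simp only [energy, PiLp.smul_apply, smul_eq_mul, Finset.mul_sum]
  refine Finset.sum_congr rfl fun i _ => Finset.sum_congr rfl fun j _ =>
    Finset.sum_congr rfl fun α _ => Finset.sum_congr rfl fun β _ => by ring

theorem energy_sub_left (A : Coeff m n) (x : Pt n) (G G' H : Grad m n) :
    energy A x (G - G') H = energy A x G H - energy A x G' H := by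
  simp only [energy, PiLp.sub_apply, mul_sub, sub_mul, Finset.sum_sub_distrib]

theorem energy_sub_right (A : Coeff m n) (x : Pt n) (G H H' : Grad m n) :
    energy A x G (H - H') = energy A x G H - energy A x G H' := by
  simp only [energy, PiLp.sub_apply, mul_sub, Finset.sum_sub_distrib]

theorem norm_sq_grad (G : Grad m n) : ‖G‖ ^ 2 = ∑ i, ∑ α, G (i, α) ^ 2 := by
  rw [EuclideanSpace.norm_sq_eq, Fintype.sum_prod_type]
  simp

/-- Cauchy–Schwarz over all quadruples `(i, j, α, β)` at once: the Euclidean norm of the array of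
products `G^j_β H^i_α` is exactly `‖G‖ ‖H‖`. -/
theorem abs_energy_le {ν : ℝ} (hν : 0 < ν) {A : Coeff m n} (hA : IsElliptic ν A) (x : Pt n)
    (G H : Grad m n) : |energy A x G H| ≤ ν⁻¹ * ‖G‖ * ‖H‖ := by
  refine abs_le_of_sq_le_sq ?_ (by positivity)
  have hE : energy A x G H = ∑ s : (Fin m × Fin m) × (Fin n × Fin n),
      A x s.2.1 s.2.2 s.1.1 s.1.2 * (G (s.1.2, s.2.2) * H (s.1.1, s.2.1)) := by
    simp only [energy, Fintype.sum_prod_type, mul_assoc]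
  have hB : ∑ s : (Fin m × Fin m) × (Fin n × Fin n), (A x s.2.1 s.2.2 s.1.1 s.1.2) ^ 2
      ≤ (ν ^ 2)⁻¹ := by
    simpa only [Fintype.sum_prod_type] using hA.bounded x
  have hGH : ∑ s : (Fin m × Fin m) × (Fin n × Fin n), (G (s.1.2, s.2.2) * H (s.1.1, s.2.1)) ^ 2
      = ‖G‖ ^ 2 * ‖H‖ ^ 2 := by
    simp only [norm_sq_grad, Fintype.sum_prod_type, mul_pow]
    rw [mul_comm, Finset.sum_mul_sum]
    refine Finset.sum_congr rfl fun i _ => Finset.sum_congr rfl fun j _ => ?_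
    rw [Finset.sum_mul_sum]
    exact Finset.sum_congr rfl fun α _ => Finset.sum_congr rfl fun β _ => mul_comm _ _
  have hCS := Finset.sum_mul_sq_le_sq_mul_sq Finset.univ
    (fun s : (Fin m × Fin m) × (Fin n × Fin n) => A x s.2.1 s.2.2 s.1.1 s.1.2)
    fun s => G (s.1.2, s.2.2) * H (s.1.1, s.2.1)
  rw [← hE, hGH] at hCS
  calc (energy A x G H) ^ 2 ≤ _ := hCS
    _ ≤ (ν ^ 2)⁻¹ * (‖G‖ ^ 2 * ‖H‖ ^ 2) := by gcongr
    _ = (ν⁻¹ * ‖G‖ * ‖H‖) ^ 2 := by ring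

theorem le_energy_self {ν : ℝ} {A : Coeff m n} (hA : IsElliptic ν A) (x : Pt n)
    (G : Grad m n) : ν * ‖G‖ ^ 2 ≤ energy A x G G := by
  rw [norm_sq_grad]
  exact hA.elliptic x fun i α => G (i, α)

theorem IsElliptic.adj {ν : ℝ} {A : Coeff m n} (hA : IsElliptic ν A) :
    IsElliptic ν (adj A) := by
  refine ⟨fun α β i j => hA.measurable β α j i, fun x ξ => ?_, fun x => ?_⟩
  · refine (hA.elliptic x ξ).trans (le_of_eq ?_)
    rw [Finset.sum_comm]
    refine Finset.sum_congr rfl fun i _ => Finset.sum_congr rfl fun j _ => ?_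
    rw [Finset.sum_comm]
    exact Finset.sum_congr rfl fun α _ => Finset.sum_congr rfl fun β _ => by
      simp only [EllipticSystem.adj]; ring
  · refine (le_of_eq ?_).trans (hA.bounded x)
    rw [Finset.sum_comm]
    refine Finset.sum_congr rfl fun i _ => Finset.sum_congr rfl fun j _ => ?_
    rw [Finset.sum_comm]
    rfl

theorem aestronglyMeasurable_coord {X ι : Type*} [Fintype ι] [MeasurableSpace X] {μ : Measure X}
    {G : X → EuclideanSpace ℝ ι} (hG : AEStronglyMeasurable G μ) (q : ι) :
    AEStronglyMeasurable (fun x => G x q) μ :=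
  (EuclideanSpace.proj (𝕜 := ℝ) q).continuous.comp_aestronglyMeasurable hG

theorem aestronglyMeasurable_energy {ν : ℝ} {A : Coeff m n} (hA : IsElliptic ν A)
    {μ : Measure (Pt n)} {G H : Pt n → Grad m n} (hG : AEStronglyMeasurable G μ)
    (hH : AEStronglyMeasurable H μ) :
    AEStronglyMeasurable (fun x => energy A x (G x) (H x)) μ := by
  unfold energy
  refine Finset.aestronglyMeasurable_fun_sum _ fun i _ =>
    Finset.aestronglyMeasurable_fun_sum _ fun j _ =>
    Finset.aestronglyMeasurable_fun_sum _ fun α _ =>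
    Finset.aestronglyMeasurable_fun_sum _ fun β _ => ?_
  exact ((hA.measurable α β i j).aestronglyMeasurable.mul
    (aestronglyMeasurable_coord hG _)).mul (aestronglyMeasurable_coord hH _)

theorem sum_mul_eq_inner (v w : Vec m) : ∑ i, v i * w i = inner ℝ v w := by
  simp [PiLp.inner_apply, mul_comm]

end Energy

/-! ### Gradients as arrays and the product rule. -/

section Gradient

variable {m n : ℕ}

/-- The array of entries of a linear map, as a continuous linear map. -/
noncomputable def toGrad : (Pt n →L[ℝ] Vec m) →L[ℝ] Grad m n :=
  LinearMap.toContinuousLinearMap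
    { toFun := fun L => WithLp.toLp 2 fun q => (L (EuclideanSpace.single q.2 1)) q.1
      map_add' := fun L L' => by ext q; simp
      map_smul' := fun c L => by ext q; simp }

theorem grad_eq_toGrad (φ : Pt n → Vec m) (x : Pt n) : grad φ x = toGrad (fderiv ℝ φ x) := rfl

/-- The tensor product `v ⊗ ℓ`, with entries `vⁱ ℓ_α`. -/
noncomputable def outer (v : Vec m) (l : Pt n →L[ℝ] ℝ) : Grad m n := toGrad (l.smulRight v)

theorem norm_outer_le (v : Vec m) (l : Pt n →L[ℝ] ℝ) :
    ‖outer v l‖ ≤ ‖(toGrad : (Pt n →L[ℝ] Vec m) →L[ℝ] Grad m n)‖ * ‖l‖ * ‖v‖ := by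
  refine (toGrad.le_opNorm _).trans (le_of_eq ?_)
  rw [ContinuousLinearMap.norm_smulRight_apply, mul_assoc]

theorem outer_apply (v : Vec m) (l : Pt n →L[ℝ] ℝ) (i : Fin m) (α : Fin n) :
    outer v l (i, α) = l (EuclideanSpace.single α 1) * v i := rfl

theorem outer_smul_right (c : ℝ) (v : Vec m) (l : Pt n →L[ℝ] ℝ) :
    outer v (c • l) = c • outer v l := by
  ext ⟨i, α⟩
  simp only [outer_apply, PiLp.smul_apply, smul_eq_mul, smul_apply]; ring

theorem outer_sub_left (v w : Vec m) (l : Pt n →L[ℝ] ℝ) :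
    outer (v - w) l = outer v l - outer w l := by
  ext ⟨i, α⟩; simp only [outer_apply, PiLp.sub_apply]; ring

theorem aestronglyMeasurable_outer {μ : Measure (Pt n)} {u : Pt n → Vec m}
    {l : Pt n → Pt n →L[ℝ] ℝ} (hu : AEStronglyMeasurable u μ) (hl : Continuous l) :
    AEStronglyMeasurable (fun x => outer (u x) (l x)) μ := by
  have h : (fun x => outer (u x) (l x)) = fun x => ∑ q : Fin m × Fin n,
      (l x (EuclideanSpace.single q.2 1) * u x q.1) • EuclideanSpace.single q (1 : ℝ) := by
    ext x q
    obtain ⟨i, α⟩ := q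
    simp [outer_apply, Pi.single_apply]
  rw [h]
  refine Finset.aestronglyMeasurable_fun_sum _ fun q _ => ?_
  exact ((hl.clm_apply continuous_const).aestronglyMeasurable.mul
    (aestronglyMeasurable_coord hu _)).smul aestronglyMeasurable_const

/-- The operator norm is at most the Euclidean norm of the entries, by Cauchy–Schwarz in each row.
It passes from Sobolev's inequality for `fderiv` to one for `|Du|`. -/
theorem norm_fderiv_le_norm_grad (φ : Pt n → Vec m) (x : Pt n) :
    ‖fderiv ℝ φ x‖ ≤ ‖grad φ x‖ := by
  refine ContinuousLinearMap.opNorm_le_bound _ (norm_nonneg _) fun v => ?_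
  refine le_of_sq_le_sq ?_ (by positivity)
  have hv : v = ∑ α, v α • EuclideanSpace.single α (1 : ℝ) := by
    ext β
    simp [Pi.single_apply]
  have h1 : ∀ i, (fderiv ℝ φ x v) i = ∑ α, v α * grad φ x (i, α) := fun i => by
    conv_lhs => rw [hv]
    simp [map_sum, grad]
  rw [EuclideanSpace.norm_sq_eq, mul_pow, norm_sq_grad, Finset.sum_mul]
  refine Finset.sum_le_sum fun i _ => ?_
  rw [h1, Real.norm_eq_abs, sq_abs]
  refine (Finset.sum_mul_sq_le_sq_mul_sq _ _ _).trans (le_of_eq ?_)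
  rw [EuclideanSpace.norm_sq_eq, mul_comm]
  simp

theorem grad_smul {η : Pt n → ℝ} {φ : Pt n → Vec m} {x : Pt n} (hη : DifferentiableAt ℝ η x)
    (hφ : DifferentiableAt ℝ φ x) :
    grad (fun z => η z • φ z) x = η x • grad φ x + outer (φ x) (fderiv ℝ η x) := by
  rw [grad_eq_toGrad, fderiv_fun_smul hη hφ, map_add, map_smul]; rfl

theorem grad_congr {φ ψ : Pt n → Vec m} {x : Pt n} (h : φ =ᶠ[𝓝 x] ψ) :
    grad φ x = grad ψ x := by rw [grad_eq_toGrad, grad_eq_toGrad, h.fderiv_eq]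

theorem grad_add {φ ψ : Pt n → Vec m} {x : Pt n} (hφ : DifferentiableAt ℝ φ x)
    (hψ : DifferentiableAt ℝ ψ x) : grad (φ + ψ) x = grad φ x + grad ψ x := by
  rw [grad_eq_toGrad, fderiv_add hφ hψ, map_add]; rfl

theorem grad_sub {φ ψ : Pt n → Vec m} {x : Pt n} (hφ : DifferentiableAt ℝ φ x)
    (hψ : DifferentiableAt ℝ ψ x) : grad (φ - ψ) x = grad φ x - grad ψ x := by
  rw [grad_eq_toGrad, fderiv_sub hφ hψ, map_sub]; rfl

theorem grad_const_smul {φ : Pt n → Vec m} {x : Pt n} (c : ℝ) (hφ : DifferentiableAt ℝ φ x) :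
    grad (c • φ) x = c • grad φ x := by
  rw [grad_eq_toGrad, fderiv_const_smul hφ, map_smul]; rfl

theorem continuous_grad {φ : Pt n → Vec m} (hφ : ContDiff ℝ ∞ φ) : Continuous (grad φ) :=
  toGrad.continuous.comp (hφ.continuous_fderiv (by simp))

end Gradient

/-! ### Test functions. -/

section Tests

variable {m n : ℕ} {F : Type*} [NormedAddCommGroup F] [NormedSpace ℝ F] {U : Set (Pt n)}

theorem IsTest.mono {V : Set (Pt n)} {φ : Pt n → F} (h : U ⊆ V) (hφ : IsTest U φ) : IsTest V φ :=
  ⟨hφ.1, hφ.2.1, hφ.2.2.trans h⟩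

theorem IsTest.differentiable {φ : Pt n → F} (hφ : IsTest U φ) : Differentiable ℝ φ :=
  hφ.1.differentiable (by simp)

theorem IsTest.eq_zero {φ : Pt n → F} (hφ : IsTest U φ) {x : Pt n} (hx : x ∉ U) : φ x = 0 :=
  image_eq_zero_of_notMem_tsupport fun h => hx (hφ.2.2 h)

theorem IsTest.memLp {φ : Pt n → F} (hφ : IsTest U φ) (p : ℝ≥0∞) (μ : Measure (Pt n))
    [IsFiniteMeasureOnCompacts μ] : MemLp φ p μ :=
  hφ.1.continuous.memLp_of_hasCompactSupport hφ.2.1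

theorem IsTest.fderiv_eq_zero {φ : Pt n → F} (hφ : IsTest U φ) {x : Pt n} (hx : x ∉ U) :
    fderiv ℝ φ x = 0 :=
  image_eq_zero_of_notMem_tsupport fun h => hx (hφ.2.2 (tsupport_fderiv_subset ℝ h))

theorem IsTest.grad_eq_zero {φ : Pt n → Vec m} (hφ : IsTest U φ) {x : Pt n} (hx : x ∉ U) :
    grad φ x = 0 := by
  rw [grad_eq_toGrad, hφ.fderiv_eq_zero hx, map_zero]

theorem IsTest.memLp_grad {φ : Pt n → Vec m} (hφ : IsTest U φ) (p : ℝ≥0∞) (μ : Measure (Pt n))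
    [IsFiniteMeasureOnCompacts μ] : MemLp (grad φ) p μ :=
  (continuous_grad hφ.1).memLp_of_hasCompactSupport
    ((hφ.2.1.fderiv ℝ).comp_left (g := toGrad) (map_zero _))

theorem IsTest.exists_bound {φ : Pt n → F} (hφ : IsTest U φ) :
    ∃ C : ℝ, 0 ≤ C ∧ (∀ x, ‖φ x‖ ≤ C) ∧ ∀ x, ‖fderiv ℝ φ x‖ ≤ C := by
  obtain ⟨C, hC⟩ := hφ.2.1.exists_bound_of_continuous hφ.1.continuous
  obtain ⟨D, hD⟩ := (hφ.2.1.fderiv ℝ).exists_bound_of_continuous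
    (hφ.1.continuous_fderiv (by simp))
  exact ⟨max C D, (norm_nonneg _).trans ((hC 0).trans (le_max_left _ _)),
    fun x => (hC x).trans (le_max_left _ _), fun x => (hD x).trans (le_max_right _ _)⟩

theorem IsTest.add {φ ψ : Pt n → F} (hφ : IsTest U φ) (hψ : IsTest U ψ) : IsTest U (φ + ψ) :=
  ⟨hφ.1.add hψ.1, hφ.2.1.add hψ.2.1,
    (tsupport_add φ ψ).trans (Set.union_subset hφ.2.2 hψ.2.2)⟩

theorem IsTest.const_smul {φ : Pt n → F} (hφ : IsTest U φ) (c : ℝ) : IsTest U (c • φ) :=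
  ⟨contDiff_const.smul hφ.1, hφ.2.1.smul_left (f := fun _ => c),
    (closure_mono (Function.support_const_smul_subset c φ)).trans hφ.2.2⟩

theorem isTest_zero : IsTest U (0 : Pt n → F) :=
  ⟨contDiff_const, HasCompactSupport.zero, by simp [tsupport]⟩

theorem IsTest.mul_self {η : Pt n → ℝ} (hη : IsTest U η) : IsTest U (fun z => η z * η z) :=
  ⟨hη.1.mul hη.1, hη.2.1.mul_left, (tsupport_mul_subset_left (f := η) (g := η)).trans hη.2.2⟩

end Tests

/-! ### Sobolev's inequality. -/

section Sobolev

variable {m n : ℕ}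

/-- The Gagliardo–Nirenberg–Sobolev inequality for the exponent `2`. -/
theorem exists_sobolev_const (m : ℕ) (hn : 3 ≤ n) : ∃ S : ℝ, 0 < S ∧
    ∀ (U : Set (Pt n)) (φ : Pt n → Vec m), IsTest U φ →
      lpNorm φ (sobolevExp n) (volume.restrict U) ≤
        S * lpNorm (grad φ) 2 (volume.restrict U) := by
  have h3 := three_le_cast hn
  set c := eLpNormLESNormFDerivOfEqInnerConst (volume : Measure (Pt n)) ((2 : NNReal) : ℝ) with hc
  refine ⟨c + 1, by positivity, fun U φ hφ => ?_⟩
  have h1 := eLpNorm_le_eLpNorm_fderiv_of_eq_inner (volume : Measure (Pt n)) (u := φ)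
    (hφ.1.of_le (by simp)) hφ.2.1 (p := 2) (p' := Real.toNNReal (2 * (n : ℝ) / ((n : ℝ) - 2)))
    (by norm_num) (by simp; omega) (by
      have : (n : ℝ) - 2 ≠ 0 := by linarith
      rw [Real.coe_toNNReal _ (div_nonneg (by positivity) (by linarith)), finrank_euclideanSpace,
        Fintype.card_fin]
      simp only [inv_div, NNReal.coe_inv, NNReal.coe_ofNat]
      field_simp)
  have h2 : eLpNorm φ (sobolevExp n) volume ≤ (c : ℝ≥0∞) * eLpNorm (grad φ) 2 volume := by
    refine h1.trans ?_
    gcongr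
    exact eLpNorm_mono (fun x => norm_fderiv_le_norm_grad φ x)
  -- The gradient of a test function vanishes off `U`, so the inequality on `ℝⁿ` holds on every `U`
  -- with the same constant.
  have h4 : lpNorm (grad φ) 2 volume = lpNorm (grad φ) 2 (volume.restrict U) := by
    have hg := hφ.memLp_grad 2 (volume : Measure (Pt n))
    rw [← toReal_eLpNorm hg.1, ← toReal_eLpNorm hg.1.restrict,
      eLpNorm_restrict_eq_of_support_subset]
    intro x hx
    by_contra hU
    exact hx (hφ.grad_eq_zero hU)
  rw [← h4]
  refine (lpNorm_mono_measure Measure.restrict_le_self (hφ.memLp _ _)).trans ?_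
  refine lpNorm_le_of_eLpNorm_le (by positivity) (hφ.memLp _ _) (hφ.memLp_grad _ _) (h2.trans ?_)
  gcongr
  rw [ENNReal.le_ofReal_iff_toReal_le (by simp) (by positivity)]
  simp

end Sobolev

/-! ### Passage to the limit in integral pairings. -/

section Pairing

variable {X E F : Type*} [MeasurableSpace X] [NormedAddCommGroup E] [NormedAddCommGroup F]
  {μ : Measure X}

/-- Subtractivity in the last slot and Hölder's inequality suffice. This form serves the energy, the
pairing with `f`, and both sides of the weak gradient identity. -/
theorem tendsto_integral_pairing {p q : ℝ≥0∞} [p.HolderConjugate q] {C : ℝ} (hC : 0 ≤ C)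
    {T : X → E → F → ℝ} (hsub : ∀ x a b c, T x a (b - c) = T x a b - T x a c)
    (hbd : ∀ x a b, |T x a b| ≤ C * ‖a‖ * ‖b‖) {f : X → E} {w : X → F} {φ : ℕ → X → F}
    (hmeas : ∀ b : X → F, AEStronglyMeasurable b μ →
      AEStronglyMeasurable (fun x => T x (f x) (b x)) μ)
    (hf : MemLp f p μ) (hw : MemLp w q μ) (hφ : ∀ k, MemLp (φ k) q μ)
    (hlim : Tendsto (fun k => lpNorm (w - φ k) q μ) atTop (𝓝 0)) :
    Tendsto (fun k => ∫ x, T x (f x) (φ k x) ∂μ) atTop (𝓝 (∫ x, T x (f x) (w x) ∂μ)) := by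
  have hI : ∀ b : X → F, MemLp b q μ → Integrable (fun x => T x (f x) (b x)) μ ∧
      |∫ x, T x (f x) (b x) ∂μ| ≤ C * lpNorm f p μ * lpNorm b q μ := fun b hb =>
    integrable_and_abs_integral_le hC hf hb (hmeas b hb.1)
      (Eventually.of_forall fun x => hbd _ _ _)
  rw [tendsto_iff_norm_sub_tendsto_zero]
  refine squeeze_zero (fun k => norm_nonneg _) (fun k => ?_)
    (by simpa using hlim.const_mul (C * lpNorm f p μ))
  have h1 := (hI _ (hw.sub (hφ k))).2
  simp only [Pi.sub_apply, hsub] at h1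
  rw [integral_sub (hI w hw).1 (hI _ (hφ k)).1] at h1
  rwa [norm_sub_rev]

end Pairing

/-! ### Limits of test functions. -/

section ZeroTrace

variable {m n : ℕ} {U : Set (Pt n)} {u w : Pt n → Vec m} {g h : Pt n → Grad m n}

/-- `w`, with gradient `h`, is a limit in `Y^{1,2}(U)` of functions in `C_c^∞(U)`. -/
structure IsY0 (U : Set (Pt n)) (w : Pt n → Vec m) (h : Pt n → Grad m n) : Prop where
  memLp : MemLp w (sobolevExp n) (volume.restrict U)
  memLp_grad : MemLp h 2 (volume.restrict U)
  approx : ∃ Φ : ℕ → Pt n → Vec m, (∀ k, IsTest U (Φ k)) ∧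
    Tendsto (fun k => lpNorm (w - Φ k) (sobolevExp n) (volume.restrict U)) atTop (𝓝 0) ∧
    Tendsto (fun k => lpNorm (h - grad (Φ k)) 2 (volume.restrict U)) atTop (𝓝 0)

theorem IsY0.lpNorm_le (hn : 3 ≤ n) {S : ℝ}
    (hS : ∀ (U : Set (Pt n)) (φ : Pt n → Vec m), IsTest U φ →
      lpNorm φ (sobolevExp n) (volume.restrict U) ≤ S * lpNorm (grad φ) 2 (volume.restrict U))
    (hw : IsY0 U w h) :
    lpNorm w (sobolevExp n) (volume.restrict U) ≤ S * lpNorm h 2 (volume.restrict U) := by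
  obtain ⟨Φ, hΦ, h1, h2⟩ := hw.approx
  refine le_of_tendsto_of_tendsto'
    (tendsto_lpNorm_of_tendsto_sub (one_le_sobolevExp hn) hw.memLp (fun k => (hΦ k).memLp _ _) h1)
    ((tendsto_lpNorm_of_tendsto_sub (by norm_num) hw.memLp_grad
      (fun k => (hΦ k).memLp_grad _ _) h2).const_mul S) fun k => hS U _ (hΦ k)

instance holderConjugate_two_two : (2 : ℝ≥0∞).HolderConjugate 2 :=
  ⟨by rw [inv_one, ENNReal.inv_two_add_inv_two]⟩

theorem integrable_inner_and_abs_le (hn : 3 ≤ n) {f w : Pt n → Vec m} {μ : Measure (Pt n)}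
    (hf : MemLp f (dualExp n) μ) (hw : MemLp w (sobolevExp n) μ) :
    Integrable (fun x => ∑ i, f x i * w x i) μ ∧
      |∫ x, ∑ i, f x i * w x i ∂μ| ≤ lpNorm f (dualExp n) μ * lpNorm w (sobolevExp n) μ := by
  have := holderConjugate_dualExp hn
  simp only [sum_mul_eq_inner]
  simpa using integrable_and_abs_integral_le zero_le_one hf hw (hf.1.inner hw.1)
    (Eventually.of_forall fun x => by simpa using abs_real_inner_le_norm (f x) (w x))

theorem integrable_energy_and_abs_le {ν : ℝ} (hν : 0 < ν) {A : Coeff m n} (hA : IsElliptic ν A)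
    {g h : Pt n → Grad m n} {μ : Measure (Pt n)} (hg : MemLp g 2 μ) (hh : MemLp h 2 μ) :
    Integrable (fun x => energy A x (g x) (h x)) μ ∧
      |∫ x, energy A x (g x) (h x) ∂μ| ≤ ν⁻¹ * lpNorm g 2 μ * lpNorm h 2 μ :=
  integrable_and_abs_integral_le (by positivity) hg hh (aestronglyMeasurable_energy hA hg.1 hh.1)
    (Eventually.of_forall fun x => abs_energy_le hν hA x _ _)

/-- A weak solution may be tested with limits of test functions. -/
theorem IsWeakSol.integral_eq (hn : 3 ≤ n) {ν : ℝ} (hν : 0 < ν) {A : Coeff m n}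
    (hA : IsElliptic ν A) {f : Pt n → Vec m} (hg : MemLp g 2 (volume.restrict U))
    (hf : MemLp f (dualExp n) (volume.restrict U)) (hsol : IsWeakSol A U g f) (hw : IsY0 U w h) :
    ∫ x in U, energy A x (g x) (h x) = ∫ x in U, ∑ i, f x i * w x i := by
  have := holderConjugate_dualExp hn
  obtain ⟨Φ, hΦ, h1, h2⟩ := hw.approx
  have t1 := tendsto_integral_pairing (p := 2) (q := 2) (inv_nonneg.2 hν.le)
    (T := energy A) (energy_sub_right A) (abs_energy_le hν hA)
    (fun b hb => aestronglyMeasurable_energy hA hg.1 hb) hg hw.memLp_grad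
    (fun k => (hΦ k).memLp_grad _ _) h2
  have t2 := tendsto_integral_pairing (p := dualExp n) (q := sobolevExp n) zero_le_one
    (T := fun (_ : Pt n) (a b : Vec m) => ∑ i, a i * b i)
    (fun x a b c => by simp only [sum_mul_eq_inner, inner_sub_right])
    (fun x a b => by
      rw [sum_mul_eq_inner, one_mul]; exact abs_real_inner_le_norm a b)
    (fun b hb => by simp only [sum_mul_eq_inner]; exact hf.1.inner hb) hf hw.memLp
    (fun k => (hΦ k).memLp _ _) h1
  exact tendsto_nhds_unique t1 (t2.congr fun k => (hsol _ (hΦ k)).symm)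

theorem norm_coord_le {ι : Type*} [Fintype ι] (v : EuclideanSpace ℝ ι) (q : ι) : |v q| ≤ ‖v‖ := by
  simpa using PiLp.norm_apply_le v q

theorem IsTest.integral_by_parts {Φ : Pt n → Vec m} (hΦ : IsTest U Φ) {φ : Pt n → ℝ}
    (hφ : IsTest U φ) (i : Fin m) (α : Fin n) :
    ∫ x in U, Φ x i * fderiv ℝ φ x (EuclideanSpace.single α 1) =
      - ∫ x in U, grad Φ x (i, α) * φ x := by
  rw [setIntegral_eq_integral_of_forall_compl_eq_zero
      fun x hx => by rw [hΦ.eq_zero hx]; simp,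
    setIntegral_eq_integral_of_forall_compl_eq_zero fun x hx => by rw [hφ.eq_zero hx, mul_zero]]
  have hc : ContDiff ℝ ∞ fun x => Φ x i :=
    (EuclideanSpace.proj (𝕜 := ℝ) i).contDiff.comp hΦ.1
  have hs : HasCompactSupport fun x => Φ x i :=
    hΦ.2.1.comp_left (g := fun v : Vec m => v i) rfl
  have hgr : ∀ x, grad Φ x (i, α) = fderiv ℝ (fun x => Φ x i) x (EuclideanSpace.single α 1) := by
    intro x
    have := ((EuclideanSpace.proj (𝕜 := ℝ) i).hasFDerivAt.comp x
      (hΦ.differentiable x).hasFDerivAt).fderiv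
    have h2 : fderiv ℝ (fun x => Φ x i) x = _ := this
    rw [h2]; rfl
  simp only [hgr]
  have c1 := hc.continuous_fderiv (by simp)
  have c2 := hφ.1.continuous_fderiv (by simp)
  refine integral_mul_fderiv_eq_neg_fderiv_mul_of_integrable ?_ ?_ ?_
    (fun x _ => hc.differentiable (by simp) x) (fun x _ => hφ.differentiable x)
  · exact ((c1.clm_apply continuous_const).mul hφ.1.continuous).integrable_of_hasCompactSupport
      hφ.2.1.mul_left
  · exact (hc.continuous.mul (c2.clm_apply continuous_const)).integrable_of_hasCompactSupport
      hs.mul_right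
  · exact (hc.continuous.mul hφ.1.continuous).integrable_of_hasCompactSupport hs.mul_right

/-- Integration by parts holds for the approximants. Both sides pass to the limit because a
derivative of `φ` and `φ` itself lie in the conjugate spaces. This makes solutions of the Dirichlet
problem admissible in (LH). -/
theorem IsY0.hasWeakGrad (hn : 3 ≤ n) (hw : IsY0 U w h) : HasWeakGrad U w h := by
  have := holderConjugate_dualExp hn
  refine ⟨locallyIntegrableOn_of_locallyIntegrable_restrict
      (hw.memLp.locallyIntegrable (one_le_sobolevExp hn)),
    locallyIntegrableOn_of_locallyIntegrable_restrict
      (hw.memLp_grad.locallyIntegrable (by norm_num)), fun φ hφ i α => ?_⟩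
  obtain ⟨Φ, hΦ, h1, h2⟩ := hw.approx
  have hbd : ∀ {ι : Type} [Fintype ι] (q : ι) (a : ℝ) (b : EuclideanSpace ℝ ι),
      |b q * a| ≤ 1 * ‖a‖ * ‖b‖ := fun q a b => by
    rw [abs_mul, one_mul, mul_comm, Real.norm_eq_abs]
    exact mul_le_mul_of_nonneg_left (norm_coord_le b q) (abs_nonneg a)
  have d1 : MemLp (fun x => fderiv ℝ φ x (EuclideanSpace.single α 1)) (dualExp n)
      (volume.restrict U) :=
    ((hφ.1.continuous_fderiv (by simp)).clm_apply continuous_const).memLp_of_hasCompactSupport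
      (hφ.2.1.fderiv_apply (𝕜 := ℝ) _)
  have t1 := tendsto_integral_pairing (p := dualExp n) (q := sobolevExp n) zero_le_one
    (T := fun (_ : Pt n) (a : ℝ) (b : Vec m) => b i * a)
    (fun x a b c => by simp only [PiLp.sub_apply, sub_mul]) (fun x a b => hbd i a b)
    (fun b hb => (aestronglyMeasurable_coord hb i).mul d1.1) d1 hw.memLp
    (fun k => (hΦ k).memLp _ _) h1
  have t2 := tendsto_integral_pairing (p := 2) (q := 2) zero_le_one
    (T := fun (_ : Pt n) (a : ℝ) (b : Grad m n) => b (i, α) * a)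
    (fun x a b c => by simp only [PiLp.sub_apply, sub_mul]) (fun x a b => hbd (i, α) a b)
    (fun b hb => (aestronglyMeasurable_coord hb (i, α)).mul (hφ.memLp 2 _).1)
    (hφ.memLp 2 (volume.restrict U)) hw.memLp_grad (fun k => (hΦ k).memLp_grad _ _) h2
  exact tendsto_nhds_unique t1 (t2.neg.congr fun k => ((hΦ k).integral_by_parts hφ i α).symm)

end ZeroTrace

/-! ### Cut-offs of functions vanishing on the lateral boundary. -/

section Cutoff

variable {m n : ℕ} {Ω : Set (Pt n)} {x : Pt n} {R : ℝ}

theorem isOpen_localDomain (hΩ : IsOpen Ω) (x : Pt n) (R : ℝ) : IsOpen (localDomain Ω x R) :=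
  hΩ.inter Metric.isOpen_ball

theorem localDomain_subset_ball : localDomain Ω x R ⊆ Metric.ball x R := Set.inter_subset_right

instance isFiniteMeasure_restrict_localDomain :
    IsFiniteMeasure (volume.restrict (localDomain Ω x R)) :=
  ⟨by
    rw [Measure.restrict_apply_univ]
    exact (measure_mono localDomain_subset_ball).trans_lt measure_ball_lt_top⟩

/-- Cutting off a function that vanishes near the boundary gives a test function. -/
theorem IsTestOff.cutoff (hΩ : IsOpen Ω) {φ : Pt n → Vec m}
    (hφ : IsTestOff (localDomain Ω x R) (localBdry Ω x R) φ) {η : Pt n → ℝ}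
    (hη : IsTest (Metric.ball x R) η) :
    IsTest (localDomain Ω x R) (fun z => η z • (localDomain Ω x R).indicator φ z) ∧
      ∀ z ∈ localDomain Ω x R, grad (fun z => η z • (localDomain Ω x R).indicator φ z) z =
        η z • grad φ z + outer (φ z) (fderiv ℝ η z) := by
  set U := localDomain Ω x R with hU
  obtain ⟨hφs, K, hK, hKU, hφK⟩ := hφ
  have hin : ∀ z ∈ U, (fun z => η z • U.indicator φ z) =ᶠ[𝓝 z] fun z => η z • φ z := fun z hz => by
    filter_upwards [(isOpen_localDomain hΩ x R).mem_nhds hz] with y hy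
    rw [Set.indicator_of_mem hy]
  -- Where `η` is supported, a point outside `U` lies in the ball but not in `Ω`. If it were in `K`,
  -- it would be in the closure of `Ω`, hence on `Σ_R(x)`, which `K` avoids. So `φ` vanishes on the
  -- part of `U` near such a point, and extension by zero stays smooth.
  have hout : ∀ z ∉ U, (fun z => η z • U.indicator φ z) =ᶠ[𝓝 z] 0 := fun z hz => by
    by_cases hzη : z ∈ tsupport η
    · have hzK : z ∉ K := fun hzK => by
        have hball := hη.2.2 hzη
        refine (hKU hzK).2 ⟨?_, hball⟩
        rw [hΩ.frontier_eq]
        exact ⟨closure_mono Set.inter_subset_left (hKU hzK).1, fun hzΩ => hz ⟨hzΩ, hball⟩⟩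
      filter_upwards [hK.isClosed.isOpen_compl.mem_nhds hzK] with y hy
      by_cases hyU : y ∈ U
      · rw [Set.indicator_of_mem hyU, hφK y (subset_closure hyU) hy, smul_zero, Pi.zero_apply]
      · rw [Set.indicator_of_notMem hyU, smul_zero, Pi.zero_apply]
    · filter_upwards [notMem_tsupport_iff_eventuallyEq.1 hzη] with y hy
      rw [hy, Pi.zero_apply, zero_smul, Pi.zero_apply]
  refine ⟨⟨?_, ?_, ?_⟩, ?_⟩
  · rw [contDiff_iff_contDiffAt]
    intro z
    by_cases hz : z ∈ U
    · exact (hη.1.smul hφs).contDiffAt.congr_of_eventuallyEq (hin z hz)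
    · exact contDiffAt_const.congr_of_eventuallyEq (hout z hz)
  · exact hη.2.1.smul_right
  · intro z hz
    by_contra hzU
    exact notMem_tsupport_iff_eventuallyEq.2 (hout z hzU) hz
  · intro z hz
    rw [grad_congr (hin z hz), grad_smul (hη.differentiable z) (hφs.differentiable (by simp) z)]

theorem eLpNorm_two_le_sobolevExp (hn : 3 ≤ n) {w : Pt n → Vec m} {μ : Measure (Pt n)}
    [IsFiniteMeasure μ] (hw : AEStronglyMeasurable w μ) :
    eLpNorm w 2 μ ≤ eLpNorm w (sobolevExp n) μ *
      μ Set.univ ^ (1 / (2 : ℝ≥0∞).toReal - 1 / (sobolevExp n).toReal) :=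
  eLpNorm_le_eLpNorm_mul_rpow_measure_univ (two_le_sobolevExp hn) hw

/-- A function that vanishes on the lateral boundary has zero trace after a cut-off. -/
theorem VanishesOn.cutoff (hn : 3 ≤ n) (hΩ : IsOpen Ω) {u : Pt n → Vec m} {g : Pt n → Grad m n}
    (hu : VanishesOn (localDomain Ω x R) (localBdry Ω x R) u g) {η : Pt n → ℝ}
    (hη : IsTest (Metric.ball x R) η) :
    IsY0 (localDomain Ω x R) (fun z => η z • u z)
      (fun z => η z • g z + outer (u z) (fderiv ℝ η z)) := by
  set U := localDomain Ω x R with hU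
  set μ := volume.restrict U with hμ
  obtain ⟨⟨-, hu1, hg1⟩, φ, hφ, lim1, lim2⟩ := hu
  obtain ⟨C, hC, hCη, hCD⟩ := hη.exists_bound
  set T := ‖(toGrad : (Pt n →L[ℝ] Vec m) →L[ℝ] Grad m n)‖ with hT
  have hηm : AEStronglyMeasurable η μ := hη.1.continuous.aestronglyMeasurable
  have hDη : Continuous (fderiv ℝ η) := hη.1.continuous_fderiv (by simp)
  have hu2 : MemLp u 2 μ := hu1.mono_exponent (two_le_sobolevExp hn)
  have hout : ∀ (v : Pt n → Vec m) z, ‖outer (v z) (fderiv ℝ η z)‖ ≤ T * C * ‖v z‖ := fun v z => by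
    refine (norm_outer_le _ _).trans ?_
    gcongr
    exact hCD z
  have m1 : MemLp (fun z => η z • u z) (sobolevExp n) μ :=
    hu1.of_le_mul (c := C) (hηm.smul hu1.1) (Eventually.of_forall fun z => by
      rw [norm_smul]; gcongr; exact hCη z)
  have m2 : MemLp (fun z => η z • g z) 2 μ :=
    hg1.of_le_mul (c := C) (hηm.smul hg1.1) (Eventually.of_forall fun z => by
      rw [norm_smul]; gcongr; exact hCη z)
  have m3 : MemLp (fun z => outer (u z) (fderiv ℝ η z)) 2 μ :=
    hu2.of_le_mul (c := T * C) (aestronglyMeasurable_outer hu1.1 hDη)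
      (Eventually.of_forall fun z => hout u z)
  have m4 : MemLp (fun z => η z • g z + outer (u z) (fderiv ℝ η z)) 2 μ := m2.add m3
  have hΦ := fun k => (hφ k).cutoff hΩ hη
  refine ⟨m1, m4, _, fun k => (hΦ k).1, ?_, ?_⟩
  · rw [tendsto_lpNorm_iff m1 fun k => (hΦ k).1.memLp _ _]
    refine tendsto_of_tendsto_of_tendsto_of_le_of_le tendsto_const_nhds
      (by simpa using ENNReal.Tendsto.const_mul lim1 (Or.inr (ENNReal.ofReal_ne_top (r := C))))
      (fun k => zero_le) fun k => ?_
    refine eLpNorm_le_mul_eLpNorm_of_ae_le_mul ?_ _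
    filter_upwards [ae_restrict_mem (isOpen_localDomain hΩ x R).measurableSet] with z hz
    simp only [Pi.sub_apply]
    rw [Set.indicator_of_mem hz, ← smul_sub, norm_smul]
    gcongr
    exact hCη z
  · rw [tendsto_lpNorm_iff m4 fun k => (hΦ k).1.memLp_grad _ _]
    -- The approximants converge to `u` in `L^(2n/(n-2))` only, while the term with `Dη` must be
    -- small in `L²`. The constant `c` is the Hölder factor, finite because `U` is bounded.
    set c := μ Set.univ ^ (1 / (2 : ℝ≥0∞).toReal - 1 / (sobolevExp n).toReal) with hc
    have hc' : c ≠ ⊤ := by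
      refine ENNReal.rpow_ne_top_of_nonneg ?_ (measure_ne_top _ _)
      have h3 := three_le_cast hn
      rw [one_div, one_div, toReal_sobolevExp_inv hn]
      simp
    have hlim : Tendsto (fun k => ENNReal.ofReal C * eLpNorm (g - grad (φ k)) 2 μ +
        ENNReal.ofReal (T * C) * (eLpNorm (u - φ k) (sobolevExp n) μ * c)) atTop (𝓝 0) := by
      simpa using (ENNReal.Tendsto.const_mul lim2
          (Or.inr (ENNReal.ofReal_ne_top (r := C)))).add
        (ENNReal.Tendsto.const_mul (ENNReal.Tendsto.mul_const lim1 (Or.inr hc'))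
          (Or.inr (ENNReal.ofReal_ne_top (r := T * C))))
    refine tendsto_of_tendsto_of_tendsto_of_le_of_le tendsto_const_nhds hlim
      (fun k => zero_le) fun k => ?_
    have hφm : AEStronglyMeasurable (u - φ k) μ :=
      hu1.1.sub (hφ k).1.continuous.aestronglyMeasurable
    have hgm : AEStronglyMeasurable (g - grad (φ k)) μ :=
      hg1.1.sub (continuous_grad (hφ k).1).aestronglyMeasurable
    have e1 : eLpNorm (fun z => η z • (g - grad (φ k)) z) 2 μ ≤
        ENNReal.ofReal C * eLpNorm (g - grad (φ k)) 2 μ := by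
      refine eLpNorm_le_mul_eLpNorm_of_ae_le_mul (Eventually.of_forall fun z => ?_) _
      rw [norm_smul]; gcongr; exact hCη z
    have e2 : eLpNorm (fun z => outer ((u - φ k) z) (fderiv ℝ η z)) 2 μ ≤
        ENNReal.ofReal (T * C) * (eLpNorm (u - φ k) (sobolevExp n) μ * c) := by
      refine (eLpNorm_le_mul_eLpNorm_of_ae_le_mul (c := T * C) (g := u - φ k)
        (Eventually.of_forall fun z => hout (u - φ k) z) _).trans ?_
      gcongr
      exact eLpNorm_two_le_sobolevExp hn hφm
    refine le_trans (le_of_eq ?_) ((eLpNorm_add_le (hηm.smul hgm)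
      (aestronglyMeasurable_outer hφm hDη) (by norm_num)).trans (add_le_add e1 e2))
    refine eLpNorm_congr_ae ?_
    filter_upwards [ae_restrict_mem (isOpen_localDomain hΩ x R).measurableSet] with z hz
    change η z • g z + outer (u z) (fderiv ℝ η z) - grad _ z =
      η z • (g z - grad (φ k) z) + outer (u z - φ k z) (fderiv ℝ η z)
    rw [(hΦ k).2 z hz, outer_sub_left, smul_sub]
    abel

end Cutoff

/-! ### The Dirichlet problem with zero boundary values. -/

section Existence

variable {m n : ℕ} {U : Set (Pt n)}

theorem norm_Lp_eq_lpNorm {X E : Type*} [MeasurableSpace X] [NormedAddCommGroup E]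
    {μ : Measure X} {p : ℝ≥0∞} (f : Lp E p μ) : ‖f‖ = lpNorm f p μ := by
  rw [Lp.norm_def, toReal_eLpNorm (Lp.aestronglyMeasurable f)]

theorem norm_toLp_eq_lpNorm {X E : Type*} [MeasurableSpace X] [NormedAddCommGroup E]
    {μ : Measure X} {p : ℝ≥0∞} {f : X → E} (hf : MemLp f p μ) : ‖hf.toLp f‖ = lpNorm f p μ := by
  rw [Lp.norm_toLp, toReal_eLpNorm hf.1]

/-- The Lax–Milgram theorem for functionals. -/
theorem _root_.IsCoercive.exists_forall_eq {V : Type*} [NormedAddCommGroup V]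
    [InnerProductSpace ℝ V] [CompleteSpace V] {B : V →L[ℝ] V →L[ℝ] ℝ} (hB : IsCoercive B)
    (l : V →L[ℝ] ℝ) : ∃ v, ∀ w, B v w = l w :=
  ⟨hB.continuousLinearEquivOfBilin.symm ((InnerProductSpace.toDual ℝ V).symm l), fun w => by
    rw [← hB.continuousLinearEquivOfBilin_apply, ContinuousLinearEquiv.apply_symm_apply,
      InnerProductSpace.toDual_symm_apply]⟩

/-- The space `C_c^∞(U)`. -/
def testSpace (m : ℕ) (U : Set (Pt n)) : Submodule ℝ (Pt n → Vec m) where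
  carrier := {φ | IsTest U φ}
  add_mem' := IsTest.add
  zero_mem' := isTest_zero
  smul_mem' c _ hφ := IsTest.const_smul hφ c

/-- The gradient, from `C_c^∞(U)` to `L²(U)`. -/
noncomputable def testGrad (m : ℕ) (U : Set (Pt n)) :
    testSpace m U →ₗ[ℝ] Lp (Grad m n) 2 (volume.restrict U) where
  toFun φ := (IsTest.memLp_grad φ.2 2 (volume.restrict U)).toLp (grad φ.1)
  map_add' φ ψ := by
    rw [← MemLp.toLp_add, MemLp.toLp_eq_toLp_iff]
    exact Eventually.of_forall fun x =>
      grad_add (IsTest.differentiable φ.2 x) (IsTest.differentiable ψ.2 x)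
  map_smul' c φ := by
    rw [RingHom.id_apply, ← MemLp.toLp_const_smul, MemLp.toLp_eq_toLp_iff]
    exact Eventually.of_forall fun x => grad_const_smul c (IsTest.differentiable φ.2 x)

/-- The inclusion of `C_c^∞(U)` in `L^p(U)`. -/
noncomputable def testIncl (m : ℕ) (U : Set (Pt n)) (p : ℝ≥0∞) :
    testSpace m U →ₗ[ℝ] Lp (Vec m) p (volume.restrict U) where
  toFun φ := (IsTest.memLp φ.2 p (volume.restrict U)).toLp φ.1
  map_add' _ _ := rfl
  map_smul' _ _ := rfl

/-- The closure in `L²(U)` of the gradients of functions in `C_c^∞(U)`. -/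
noncomputable def gradSpace (m : ℕ) (U : Set (Pt n)) :
    Submodule ℝ (Lp (Grad m n) 2 (volume.restrict U)) :=
  (testGrad m U).range.topologicalClosure

instance completeSpace_gradSpace : CompleteSpace (gradSpace m U) :=
  (Submodule.isClosed_topologicalClosure _).completeSpace_coe

/-- The gradient, from `C_c^∞(U)` to `gradSpace`. -/
noncomputable def testToGradSpace (m : ℕ) (U : Set (Pt n)) :
    testSpace m U →ₗ[ℝ] gradSpace m U :=
  (testGrad m U).codRestrict _ fun φ => Submodule.le_topologicalClosure _ ⟨φ, rfl⟩

theorem denseRange_testToGradSpace : DenseRange (testToGradSpace m U) := by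
  refine Subtype.dense_iff.2 fun v hv => ?_
  rw [← Set.range_comp]
  exact hv

theorem norm_testToGradSpace (φ : testSpace m U) :
    ‖testToGradSpace m U φ‖ = lpNorm (grad φ.1) 2 (volume.restrict U) :=
  norm_toLp_eq_lpNorm (IsTest.memLp_grad φ.2 2 (volume.restrict U))

/-- The energy as a bilinear form on `L²(U)`. -/
noncomputable def energyBilin {ν : ℝ} (hν : 0 < ν) {A : Coeff m n} (hA : IsElliptic ν A)
    (U : Set (Pt n)) : Lp (Grad m n) 2 (volume.restrict U) →ₗ[ℝ]
      Lp (Grad m n) 2 (volume.restrict U) →ₗ[ℝ] ℝ :=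
    LinearMap.mk₂ ℝ (fun G H => ∫ x in U, energy A x (G x) (H x))
      (fun G G' H => by
        rw [← integral_add (integrable_energy_and_abs_le hν hA (Lp.memLp G) (Lp.memLp H)).1
          (integrable_energy_and_abs_le hν hA (Lp.memLp G') (Lp.memLp H)).1]
        refine integral_congr_ae ?_
        filter_upwards [Lp.coeFn_add G G'] with x hx
        rw [hx, Pi.add_apply, energy_add_left])
      (fun c G H => by
        rw [smul_eq_mul, ← integral_const_mul]
        refine integral_congr_ae ?_
        filter_upwards [Lp.coeFn_smul c G] with x hx
        rw [hx, Pi.smul_apply, energy_smul_left])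
      (fun G H H' => by
        rw [← integral_add (integrable_energy_and_abs_le hν hA (Lp.memLp G) (Lp.memLp H)).1
          (integrable_energy_and_abs_le hν hA (Lp.memLp G) (Lp.memLp H')).1]
        refine integral_congr_ae ?_
        filter_upwards [Lp.coeFn_add H H'] with x hx
        rw [hx, Pi.add_apply, energy_add_right])
      (fun c G H => by
        rw [smul_eq_mul, ← integral_const_mul]
        refine integral_congr_ae ?_
        filter_upwards [Lp.coeFn_smul c H] with x hx
        rw [hx, Pi.smul_apply, energy_smul_right])

theorem energyBilin_apply {ν : ℝ} (hν : 0 < ν) {A : Coeff m n} (hA : IsElliptic ν A)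
    (G H : Lp (Grad m n) 2 (volume.restrict U)) :
    energyBilin hν hA U G H = ∫ x in U, energy A x (G x) (H x) := rfl

theorem norm_energyBilin_le {ν : ℝ} (hν : 0 < ν) {A : Coeff m n} (hA : IsElliptic ν A)
    (G H : Lp (Grad m n) 2 (volume.restrict U)) :
    ‖energyBilin hν hA U G H‖ ≤ ν⁻¹ * ‖G‖ * ‖H‖ := by
  rw [norm_Lp_eq_lpNorm, norm_Lp_eq_lpNorm, energyBilin_apply, Real.norm_eq_abs]
  exact (integrable_energy_and_abs_le hν hA (Lp.memLp G) (Lp.memLp H)).2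

/-- The energy as a bounded bilinear form on `L²(U)`. -/
noncomputable def energyForm {ν : ℝ} (hν : 0 < ν) {A : Coeff m n} (hA : IsElliptic ν A)
    (U : Set (Pt n)) : Lp (Grad m n) 2 (volume.restrict U) →L[ℝ]
      Lp (Grad m n) 2 (volume.restrict U) →L[ℝ] ℝ :=
  (energyBilin hν hA U).mkContinuous₂ ν⁻¹ (norm_energyBilin_le hν hA)

theorem mul_lpNorm_sq_le_integral_energy {ν : ℝ} (hν : 0 < ν) {A : Coeff m n}
    (hA : IsElliptic ν A) {μ : Measure (Pt n)} {h : Pt n → Grad m n} (hh : MemLp h 2 μ) :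
    ν * lpNorm h 2 μ ^ 2 ≤ ∫ x, energy A x (h x) (h x) ∂μ := by
  rw [lpNorm_sq_eq_integral hh.1, ← integral_const_mul]
  refine integral_mono (hh.norm.integrable_sq.const_mul ν)
    (integrable_energy_and_abs_le hν hA hh hh).1 fun x => le_energy_self hA x _

theorem isCoercive_energyForm {ν : ℝ} (hν : 0 < ν) {A : Coeff m n} (hA : IsElliptic ν A) :
    IsCoercive ((energyForm hν hA U).bilinearComp (gradSpace m U).subtypeL
      (gradSpace m U).subtypeL) := by
  refine ⟨ν, hν, fun v => ?_⟩
  have h := mul_lpNorm_sq_le_integral_energy hν hA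
    (Lp.memLp (v : Lp (Grad m n) 2 (volume.restrict U)))
  rw [← norm_Lp_eq_lpNorm] at h
  rw [mul_assoc, ← sq]
  exact h

/-- Testing against `f`, as a functional on `C_c^∞(U)`. -/
noncomputable def testFunctional (hn : 3 ≤ n) {f : Pt n → Vec m}
    (hf : MemLp f (dualExp n) (volume.restrict U)) : testSpace m U →ₗ[ℝ] ℝ where
  toFun φ := ∫ x in U, ∑ i, f x i * φ.1 x i
  map_add' φ ψ := by
    rw [← integral_add (integrable_inner_and_abs_le hn hf (IsTest.memLp φ.2 _ _)).1
      (integrable_inner_and_abs_le hn hf (IsTest.memLp ψ.2 _ _)).1]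
    refine integral_congr_ae (Eventually.of_forall fun x => ?_)
    simp only [Submodule.coe_add, Pi.add_apply, PiLp.add_apply, mul_add, Finset.sum_add_distrib]
  map_smul' c φ := by
    rw [RingHom.id_apply, smul_eq_mul, ← integral_const_mul]
    refine integral_congr_ae (Eventually.of_forall fun x => ?_)
    simp only [Submodule.coe_smul, Pi.smul_apply, PiLp.smul_apply, smul_eq_mul, Finset.mul_sum]
    exact Finset.sum_congr rfl fun i _ => by ring

theorem norm_sub_toLp_eq_lpNorm {X E : Type*} [MeasurableSpace X] [NormedAddCommGroup E]
    {μ : Measure X} {p : ℝ≥0∞} (F : Lp E p μ) {φ : X → E} (hφ : MemLp φ p μ) :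
    ‖F - hφ.toLp φ‖ = lpNorm ((F : X → E) - φ) p μ := by
  rw [norm_Lp_eq_lpNorm]
  refine lpNorm_congr_ae ((Lp.coeFn_sub _ _).trans ?_)
  filter_upwards [hφ.coeFn_toLp] with x hx
  rw [Pi.sub_apply, Pi.sub_apply, hx]

theorem tendsto_norm_sub_nhds_zero {E : Type*} [NormedAddCommGroup E] {x : E} {s : ℕ → E}
    (h : Tendsto s atTop (𝓝 x)) : Tendsto (fun k => ‖x - s k‖) atTop (𝓝 0) :=
  (tendsto_iff_norm_sub_tendsto_zero.1 h).congr fun _ => norm_sub_rev _ _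

/-- Elements of `gradSpace` are only limits of gradients. By Sobolev's inequality the map from `grad
φ` to `φ` is bounded, so it extends to the closure and recovers the function itself. -/
theorem exists_isY0_of_mem_gradSpace (hn : 3 ≤ n) {S : ℝ}
    (hS : ∀ (U : Set (Pt n)) (φ : Pt n → Vec m), IsTest U φ →
      lpNorm φ (sobolevExp n) (volume.restrict U) ≤ S * lpNorm (grad φ) 2 (volume.restrict U))
    (v : gradSpace m U) :
    ∃ w : Pt n → Vec m, IsY0 U w (v : Lp (Grad m n) 2 (volume.restrict U)) := by
  have : Fact (1 ≤ sobolevExp n) := ⟨one_le_sobolevExp hn⟩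
  have hd : DenseRange (testToGradSpace m U) := denseRange_testToGradSpace
  have hJ : ∀ φ, ‖testIncl m U (sobolevExp n) φ‖ ≤ S * ‖testToGradSpace m U φ‖ := fun φ => by
    rw [norm_testToGradSpace]
    exact (norm_toLp_eq_lpNorm (IsTest.memLp φ.2 _ (volume.restrict U))).trans_le
      (hS U φ.1 φ.2)
  obtain ⟨J, hJe⟩ : ∃ J : gradSpace m U →L[ℝ] Lp (Vec m) (sobolevExp n) (volume.restrict U),
      ∀ φ, J (testToGradSpace m U φ) = testIncl m U (sobolevExp n) φ :=
    ⟨_, LinearMap.extendOfNorm_eq hd ⟨_, hJ⟩⟩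
  obtain ⟨s, hs, hlim⟩ := mem_closure_iff_seq_limit.1 (hd v)
  choose φ hφ using hs
  refine ⟨J v, Lp.memLp _, Lp.memLp _, fun k => (φ k).1, fun k => (φ k).2, ?_, ?_⟩
  · refine (tendsto_norm_sub_nhds_zero ((J.continuous.tendsto v).comp hlim)).congr fun k => ?_
    rw [Function.comp_apply, ← hφ, hJe]
    exact norm_sub_toLp_eq_lpNorm _ (IsTest.memLp (φ k).2 _ (volume.restrict U))
  · refine (tendsto_norm_sub_nhds_zero hlim).congr fun k => ?_
    rw [← hφ]
    exact norm_sub_toLp_eq_lpNorm _ (IsTest.memLp_grad (φ k).2 2 (volume.restrict U))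

/-- Lax–Milgram in the space of gradients, where coercivity is ellipticity itself. By Hölder and
Sobolev, testing against `f` is bounded in the norm of the gradient, so it extends to a functional
on that space. -/
theorem exists_mem_gradSpace_isWeakSol (hn : 3 ≤ n) {ν : ℝ} (hν : 0 < ν) {A : Coeff m n}
    (hA : IsElliptic ν A) {S : ℝ}
    (hS : ∀ (U : Set (Pt n)) (φ : Pt n → Vec m), IsTest U φ →
      lpNorm φ (sobolevExp n) (volume.restrict U) ≤ S * lpNorm (grad φ) 2 (volume.restrict U))
    {f : Pt n → Vec m} (hf : MemLp f (dualExp n) (volume.restrict U)) :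
    ∃ v : gradSpace m U, IsWeakSol A U (v : Lp (Grad m n) 2 (volume.restrict U)) f := by
  have hd : DenseRange (testToGradSpace m U) := denseRange_testToGradSpace
  have hl : ∀ φ, ‖testFunctional hn hf φ‖ ≤
      lpNorm f (dualExp n) (volume.restrict U) * S * ‖testToGradSpace m U φ‖ := fun φ => by
    rw [norm_testToGradSpace, mul_assoc]
    refine (integrable_inner_and_abs_le hn hf (IsTest.memLp φ.2 _ _)).2.trans ?_
    exact mul_le_mul_of_nonneg_left (hS U φ.1 φ.2) lpNorm_nonneg
  obtain ⟨l, hle⟩ : ∃ l : gradSpace m U →L[ℝ] ℝ,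
      ∀ φ, l (testToGradSpace m U φ) = testFunctional hn hf φ :=
    ⟨_, LinearMap.extendOfNorm_eq hd ⟨_, hl⟩⟩
  obtain ⟨v, hv⟩ := (isCoercive_energyForm (U := U) hν hA).exists_forall_eq l
  refine ⟨v, fun ψ hψ => ?_⟩
  refine Eq.trans ?_ ((hv (testToGradSpace m U ⟨ψ, hψ⟩)).trans (hle _))
  change _ = ∫ x in U, energy A x _ _
  refine integral_congr_ae ?_
  filter_upwards [MemLp.coeFn_toLp (IsTest.memLp_grad hψ 2 (volume.restrict U))] with x hx
  exact congrArg (energy A x _) hx.symm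

/-- The solution is tested with itself: `ν ‖h‖² ≤ ∫ f·w ≤ S ‖f‖ ‖h‖`. A factor `‖h‖` is then
cancelled, unless it is zero. -/
theorem IsY0.lpNorm_grad_le (hn : 3 ≤ n) {ν : ℝ} (hν : 0 < ν) {A : Coeff m n}
    (hA : IsElliptic ν A) {S : ℝ} (hS0 : 0 < S)
    (hS : ∀ (U : Set (Pt n)) (φ : Pt n → Vec m), IsTest U φ →
      lpNorm φ (sobolevExp n) (volume.restrict U) ≤ S * lpNorm (grad φ) 2 (volume.restrict U))
    {f w : Pt n → Vec m} {h : Pt n → Grad m n} (hf : MemLp f (dualExp n) (volume.restrict U))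
    (hY : IsY0 U w h) (hW : IsWeakSol A U h f) :
    lpNorm h 2 (volume.restrict U) ≤
        ν⁻¹ * S * lpNorm f (dualExp n) (volume.restrict U) := by
  have h1 := mul_lpNorm_sq_le_integral_energy hν hA hY.memLp_grad
  rw [hW.integral_eq hn hν hA hY.memLp_grad hf hY] at h1
  have h2 := (le_abs_self _).trans (integrable_inner_and_abs_le hn hf hY.memLp).2
  have h3 := mul_le_mul_of_nonneg_left (hY.lpNorm_le hn hS)
    (lpNorm_nonneg (f := f) (p := dualExp n) (μ := volume.restrict U))
  have hX : 0 ≤ lpNorm h 2 (volume.restrict U) := lpNorm_nonneg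
  generalize lpNorm h 2 (volume.restrict U) = X at *
  have hY0 : 0 ≤ lpNorm f (dualExp n) (volume.restrict U) := lpNorm_nonneg
  generalize lpNorm f (dualExp n) (volume.restrict U) = Y at *
  rw [mul_assoc, inv_mul_eq_div, le_div_iff₀ hν]
  rcases hX.eq_or_lt with h0 | h0
  · rw [← h0, zero_mul]; positivity
  · refine le_of_mul_le_mul_right ?_ h0
    linarith

/-- Solvability of the Dirichlet problem with zero boundary values, with an energy estimate. -/
theorem exists_isY0_isWeakSol (hn : 3 ≤ n) {ν : ℝ} (hν : 0 < ν) {A : Coeff m n}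
    (hA : IsElliptic ν A) {S : ℝ} (hS0 : 0 < S)
    (hS : ∀ (U : Set (Pt n)) (φ : Pt n → Vec m), IsTest U φ →
      lpNorm φ (sobolevExp n) (volume.restrict U) ≤ S * lpNorm (grad φ) 2 (volume.restrict U))
    {f : Pt n → Vec m} (hf : MemLp f (dualExp n) (volume.restrict U)) :
    ∃ (w : Pt n → Vec m) (h : Pt n → Grad m n), IsY0 U w h ∧ IsWeakSol A U h f ∧
      lpNorm h 2 (volume.restrict U) ≤
        ν⁻¹ * S * lpNorm f (dualExp n) (volume.restrict U) := by
  obtain ⟨v, hv⟩ := exists_mem_gradSpace_isWeakSol hn hν hA hS hf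
  obtain ⟨w, hw⟩ := exists_isY0_of_mem_gradSpace hn hS v
  exact ⟨w, _, hw, hv, hw.lpNorm_grad_le hn hν hA hS0 hS hf hv⟩

end Existence

/-! ### Cut-off functions and Caccioppoli's inequality. -/

section Caccioppoli

variable {m n : ℕ}

/-- A single bump function is rescaled, so the constant depends on `n` only. The plateau of radius
`3R/4` contains every ball of radius `R/4` centred in `B_{R/2}(x)`. -/
theorem exists_cutoff_const (n : ℕ) : ∃ C : ℝ, 0 < C ∧ ∀ (x : Pt n) (R : ℝ), 0 < R →
    ∃ η : Pt n → ℝ, IsTest (Metric.ball x R) η ∧ (∀ z, 0 ≤ η z) ∧ (∀ z, η z ≤ 1) ∧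
      (∀ z ∈ Metric.ball x (3 / 4 * R), η z = 1) ∧ ∀ z, ‖fderiv ℝ η z‖ ≤ C / R := by
  let b : ContDiffBump (0 : Pt n) := ⟨3 / 4, 7 / 8, by norm_num, by norm_num⟩
  have hb : ContDiff ℝ ∞ b := b.contDiff
  obtain ⟨C, hC⟩ := (b.hasCompactSupport.fderiv ℝ).exists_bound_of_continuous
    (hb.continuous_fderiv (by simp))
  have hC0 : 0 ≤ C := (norm_nonneg _).trans (hC 0)
  refine ⟨C + 1, by positivity, fun x R hR => ?_⟩
  have hLd : ∀ z : Pt n, HasFDerivAt (fun z : Pt n => R⁻¹ • (z - x))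
      (R⁻¹ • ContinuousLinearMap.id ℝ (Pt n)) z := fun z =>
    ((hasFDerivAt_id z).sub_const x).const_smul R⁻¹
  have hL : ContDiff ℝ ∞ (fun z : Pt n => R⁻¹ • (z - x)) :=
    (contDiff_id.sub contDiff_const).const_smul R⁻¹
  have hnorm : ∀ z : Pt n, ‖R⁻¹ • (z - x)‖ = dist z x / R := fun z => by
    rw [norm_smul, Real.norm_of_nonneg (by positivity), dist_eq_norm, inv_mul_eq_div]
  have hsupp : tsupport (fun z => b (R⁻¹ • (z - x))) ⊆ Metric.closedBall x (7 / 8 * R) := by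
    refine closure_minimal (fun z hz => ?_) Metric.isClosed_closedBall
    have h1 : R⁻¹ • (z - x) ∈ Function.support b := hz
    rw [b.support_eq, mem_ball_zero_iff, hnorm] at h1
    have h2 : dist z x / R < 7 / 8 := h1
    rw [div_lt_iff₀ hR] at h2
    exact h2.le
  refine ⟨fun z => b (R⁻¹ • (z - x)), ⟨hb.comp hL, ?_, ?_⟩, fun z => b.nonneg,
    fun z => b.le_one, fun z hz => ?_, fun z => ?_⟩
  · exact (isCompact_closedBall x (7 / 8 * R)).of_isClosed_subset (isClosed_tsupport _) hsupp
  · exact hsupp.trans (Metric.closedBall_subset_ball (by linarith))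
  · refine b.one_of_mem_closedBall ?_
    rw [mem_closedBall_zero_iff, hnorm]
    have h2 : dist z x < 3 / 4 * R := hz
    exact (div_le_iff₀ hR).2 h2.le
  · have h1 := ((hb.differentiable (by simp) _).hasFDerivAt.comp z (hLd z)).fderiv
    have h2 : fderiv ℝ (fun z => b (R⁻¹ • (z - x))) z = _ := h1
    rw [h2]
    refine (ContinuousLinearMap.opNorm_comp_le _ _).trans ?_
    rw [div_eq_mul_inv]
    refine mul_le_mul ((hC _).trans (by linarith)) ?_ (norm_nonneg _) (by positivity)
    rw [norm_smul, Real.norm_of_nonneg (by positivity)]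
    exact mul_le_of_le_one_right (by positivity) ContinuousLinearMap.norm_id_le

/-- Caccioppoli's inequality up to the boundary. -/
theorem VanishesOn.caccioppoli (hn : 3 ≤ n) {ν : ℝ} (hν : 0 < ν) {A : Coeff m n}
    (hA : IsElliptic ν A) {S : ℝ} (hS0 : 0 < S)
    (hS : ∀ (U : Set (Pt n)) (φ : Pt n → Vec m), IsTest U φ →
      lpNorm φ (sobolevExp n) (volume.restrict U) ≤ S * lpNorm (grad φ) 2 (volume.restrict U))
    {Ω : Set (Pt n)} (hΩ : IsOpen Ω) {x : Pt n} {R : ℝ} {u f : Pt n → Vec m} {g : Pt n → Grad m n}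
    (hu : VanishesOn (localDomain Ω x R) (localBdry Ω x R) u g)
    (hf : MemLp f (dualExp n) (volume.restrict (localDomain Ω x R)))
    (hsol : IsWeakSol A (localDomain Ω x R) g f) {η : Pt n → ℝ}
    (hη : IsTest (Metric.ball x R) η) (h0 : ∀ z, 0 ≤ η z) (h1 : ∀ z, η z ≤ 1) :
    lpNorm (fun z => η z • g z) 2 (volume.restrict (localDomain Ω x R)) ≤
      ν⁻¹ * (2 * S * lpNorm f (dualExp n) (volume.restrict (localDomain Ω x R)) +
        2 * ν⁻¹ * lpNorm (fun z => outer (u z) (fderiv ℝ η z)) 2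
          (volume.restrict (localDomain Ω x R))) +
      lpNorm (fun z => outer (u z) (fderiv ℝ η z)) 2 (volume.restrict (localDomain Ω x R)) := by
  set μ := volume.restrict (localDomain Ω x R) with hμ
  obtain ⟨C, hC, hCη, hCD⟩ := hη.exists_bound
  have hu1 := hu.1.2.1
  have hg1 := hu.1.2.2
  have hηm : AEStronglyMeasurable η μ := hη.1.continuous.aestronglyMeasurable
  have m2 : MemLp (fun z => η z • g z) 2 μ :=
    hg1.of_le_mul (c := C) (hηm.smul hg1.1) (Eventually.of_forall fun z => by
      rw [norm_smul]; gcongr; exact hCη z)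
  have m3 : MemLp (fun z => outer (u z) (fderiv ℝ η z)) 2 μ :=
    (hu1.mono_exponent (two_le_sobolevExp hn)).of_le_mul
      (c := ‖(toGrad : (Pt n →L[ℝ] Vec m) →L[ℝ] Grad m n)‖ * C)
      (aestronglyMeasurable_outer hu1.1 (hη.1.continuous_fderiv (by simp)))
      (Eventually.of_forall fun z => by
        refine (norm_outer_le _ _).trans ?_
        gcongr
        exact hCD z)
  have Y1 := hu.cutoff hn hΩ hη
  have Y2 := hu.cutoff hn hΩ hη.mul_self
  have key := hsol.integral_eq hn hν hA hg1 hf Y2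
  -- The equation is tested with `η²u`. Since `D(η²) = 2η Dη`, one factor `η` can be moved onto `g`.
  have hpt : ∀ z, energy A z (g z) ((η z * η z) • g z +
      outer (u z) (fderiv ℝ (fun z => η z * η z) z)) =
      energy A z (η z • g z) (η z • g z) +
        2 * energy A z (η z • g z) (outer (u z) (fderiv ℝ η z)) := fun z => by
    rw [fderiv_fun_mul (hη.differentiable z) (hη.differentiable z), ← two_smul ℝ,
      outer_smul_right, outer_smul_right, energy_add_right]
    simp only [energy_smul_left, energy_smul_right]
    ring
  have i1 := integrable_energy_and_abs_le hν hA m2 m2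
  have i2 := integrable_energy_and_abs_le hν hA m2 m3
  simp only [hpt] at key
  rw [integral_add i1.1 (i2.1.const_mul 2), integral_const_mul] at key
  have c1 := mul_lpNorm_sq_le_integral_energy hν hA m2
  have c2 := (le_abs_self _).trans (integrable_inner_and_abs_le hn hf Y2.memLp).2
  -- As `0 ≤ η ≤ 1`, the function `η²u` is dominated by `ηu`, whose Sobolev bound involves only the
  -- two norms already present.
  have c3 : lpNorm (fun z => (η z * η z) • u z) (sobolevExp n) μ ≤
      S * (lpNorm (fun z => η z • g z) 2 μ + lpNorm (fun z => outer (u z) (fderiv ℝ η z)) 2 μ) := by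
    refine (lpNorm_mono_ae Y1.memLp (Eventually.of_forall fun z => ?_)).trans
      ((Y1.lpNorm_le hn hS).trans (mul_le_mul_of_nonneg_left (lpNorm_add_le m2 (by norm_num))
        hS0.le))
    rw [mul_smul, norm_smul, Real.norm_of_nonneg (h0 z)]
    exact mul_le_of_le_one_left (norm_nonneg _) (h1 z)
  have c4 := neg_le_of_abs_le i2.2
  have hF : 0 ≤ lpNorm f (dualExp n) μ := lpNorm_nonneg
  have hX : 0 ≤ lpNorm (fun z => η z • g z) 2 μ := lpNorm_nonneg
  have hY : 0 ≤ lpNorm (fun z => outer (u z) (fderiv ℝ η z)) 2 μ := lpNorm_nonneg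
  have c5 := mul_le_mul_of_nonneg_left c3 hF
  generalize lpNorm f (dualExp n) μ = F at *
  generalize lpNorm (fun z => η z • g z) 2 μ = X at *
  generalize lpNorm (fun z => outer (u z) (fderiv ℝ η z)) 2 μ = Y at *
  have hν' : 0 < ν⁻¹ := inv_pos.2 hν
  -- If `X ≤ Y` the claim is immediate from the last summand. Otherwise `X + Y ≤ 2X`, and `νX² ≤
  -- 2FSX + 2ν⁻¹XY` can be divided by `X`.
  rcases le_total X Y with hXY | hXY
  · refine hXY.trans (le_add_of_nonneg_left (by positivity))
  · refine le_trans ?_ (le_add_of_nonneg_right hY)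
    rw [inv_mul_eq_div, le_div_iff₀ hν]
    rcases hX.eq_or_lt with hX0 | hX0
    · rw [← hX0, zero_mul]; positivity
    · refine le_of_mul_le_mul_right ?_ hX0
      have : F * (S * (X + Y)) ≤ F * (S * (X + X)) := by gcongr
      nlinarith

end Caccioppoli

/-! ### Averages over concentric balls. -/

section Averages

variable {m n : ℕ}

theorem integral_unitClosedBall_comp {E : Type*} [NormedAddCommGroup E] [NormedSpace ℝ E]
    (f : Pt n → E) (y : Pt n) {ρ : ℝ} (hρ : 0 < ρ) :
    ∫ z in Metric.closedBall (0 : Pt n) 1, f (y + ρ • z) =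
      (ρ ^ n)⁻¹ • ∫ z in Metric.closedBall y ρ, f z := by
  have h1 := Measure.setIntegral_comp_smul volume (fun z => f (y + z))
    (Metric.closedBall (0 : Pt n) 1) hρ.ne'
  have h2 := (measurePreserving_add_left volume y).setIntegral_preimage_emb
    (measurableEmbedding_addLeft y) f (Metric.closedBall y ρ)
  have h3 : (fun z => y + z) ⁻¹' Metric.closedBall y ρ = Metric.closedBall (0 : Pt n) ρ := by
    ext z; simp [dist_eq_norm]
  rw [h3] at h2
  rw [h1, smul_unitClosedBall, Real.norm_of_nonneg hρ.le, h2, finrank_euclideanSpace,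
    Fintype.card_fin, abs_of_pos (by positivity)]

theorem volume_real_closedBall (y : Pt n) {ρ : ℝ} (hρ : 0 < ρ) :
    volume.real (Metric.closedBall y ρ) = ρ ^ n * volume.real (Metric.closedBall (0 : Pt n) 1) := by
  have h := integral_unitClosedBall_comp (fun _ : Pt n => (1 : ℝ)) y hρ
  simp only [setIntegral_const, smul_eq_mul, mul_one] at h
  rw [h, mul_inv_cancel_left₀ (by positivity)]

theorem volume_real_unitClosedBall_pos (n : ℕ) :
    0 < volume.real (Metric.closedBall (0 : Pt n) 1) :=
  ENNReal.toReal_pos (Metric.measure_closedBall_pos volume _ one_pos).ne'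
    measure_closedBall_lt_top.ne

theorem setAverage_closedBall {E : Type*} [NormedAddCommGroup E] [NormedSpace ℝ E]
    (f : Pt n → E) (y : Pt n) {ρ : ℝ} (hρ : 0 < ρ) :
    ⨍ z in Metric.closedBall y ρ, f z =
      (volume.real (Metric.closedBall (0 : Pt n) 1))⁻¹ •
        ∫ z in Metric.closedBall (0 : Pt n) 1, f (y + ρ • z) := by
  rw [setAverage_eq, volume_real_closedBall y hρ, integral_unitClosedBall_comp f y hρ, smul_smul,
    mul_inv, mul_comm]

instance isFiniteMeasure_restrict_closedBall (y : Pt n) (ρ : ℝ) :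
    IsFiniteMeasure (volume.restrict (Metric.closedBall y ρ)) :=
  ⟨by rw [Measure.restrict_apply_univ]; exact measure_closedBall_lt_top⟩

theorem hasDerivAt_integral_unitClosedBall {U : Set (Pt n)} {Φ : Pt n → Vec m} (hΦ : IsTest U Φ)
    (y : Pt n) (ρ : ℝ) :
    HasDerivAt (fun ρ => ∫ z in Metric.closedBall (0 : Pt n) 1, Φ (y + ρ • z))
      (∫ z in Metric.closedBall (0 : Pt n) 1, fderiv ℝ Φ (y + ρ • z) z) ρ := by
  obtain ⟨C, hC, hCΦ, hCD⟩ := hΦ.exists_bound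
  have hDc := hΦ.1.continuous_fderiv (by simp)
  refine (hasDerivAt_integral_of_dominated_loc_of_deriv_le (s := Set.univ) (bound := fun _ => C)
    (F' := fun ρ z => fderiv ℝ Φ (y + ρ • z) z) Filter.univ_mem
    (Eventually.of_forall fun ρ => ?_) ?_ ?_ ?_ (integrable_const C) ?_).2
  · exact (hΦ.1.continuous.comp (by fun_prop)).aestronglyMeasurable
  · exact (hΦ.1.continuous.comp (by fun_prop)).continuousOn.integrableOn_compact
      (isCompact_closedBall _ _)
  · exact ((hDc.comp (by fun_prop)).clm_apply continuous_id).aestronglyMeasurable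
  · filter_upwards [ae_restrict_mem Metric.isClosed_closedBall.measurableSet] with z hz ρ _
    refine (ContinuousLinearMap.le_opNorm _ _).trans ?_
    rw [mem_closedBall_zero_iff] at hz
    exact (mul_le_of_le_one_right (norm_nonneg _) hz).trans (hCD _)
  · refine Eventually.of_forall fun z ρ _ => ?_
    have h1 : HasDerivAt (fun ρ : ℝ => y + ρ • z) z ρ := by
      simpa using ((hasDerivAt_id ρ).smul_const z).const_add y
    exact (hΦ.differentiable _).hasFDerivAt.comp_hasDerivAt ρ h1

theorem lpNorm_one_le_lpNorm_two {E X : Type*} [MeasurableSpace X] [NormedAddCommGroup E]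
    {μ : Measure X} [IsFiniteMeasure μ] {f : X → E} (hf : MemLp f 2 μ) :
    lpNorm f 1 μ ≤ (μ.real Set.univ) ^ (1 / 2 : ℝ) * lpNorm f 2 μ := by
  have := lpNorm_le_mul_measure_rpow (p := 1) (by norm_num) hf
  norm_num at this ⊢
  exact this

/-- After rescaling to the unit ball, only the radius `ρ` varies. The derivative of the integral of
`Φ(y + ρz)` is at most `ρ^(-n)` times the integral of `|DΦ|` over `B_ρ(y)`. Cauchy–Schwarz and the
mean value inequality on `[θr, r]` finish, the bound `ρ ≥ θr` costing the factor `θ^(-n)`. -/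
theorem IsTest.norm_setAverage_sub_le {U : Set (Pt n)} {Φ : Pt n → Vec m} (hΦ : IsTest U Φ)
    (y : Pt n) {r θ : ℝ} (hr : 0 < r) (hθ : 0 < θ) (hθ1 : θ ≤ 1) :
    ‖(⨍ z in Metric.closedBall y (θ * r), Φ z) - ⨍ z in Metric.closedBall y r, Φ z‖ ≤
      (volume.real (Metric.closedBall (0 : Pt n) 1)) ^ (-1 / 2 : ℝ) * (θ ^ n)⁻¹ *
        r ^ (1 - (n : ℝ) / 2) * lpNorm (grad Φ) 2 (volume.restrict (Metric.closedBall y r)) := by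
  set κ := volume.real (Metric.closedBall (0 : Pt n) 1) with hκ
  have hκ0 : 0 < κ := volume_real_unitClosedBall_pos n
  set L := lpNorm (grad Φ) 2 (volume.restrict (Metric.closedBall y r)) with hL
  have hL0 : 0 ≤ L := lpNorm_nonneg
  have hθr : 0 < θ * r := by positivity
  have hle : θ * r ≤ r := mul_le_of_le_one_left hr.le hθ1
  have hgc : Continuous (fun z => ‖grad Φ z‖) := (continuous_grad hΦ.1).norm
  have hbound : ∀ ρ ∈ Set.Icc (θ * r) r,
      ‖∫ z in Metric.closedBall (0 : Pt n) 1, fderiv ℝ Φ (y + ρ • z) z‖ ≤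
        ((θ * r) ^ n)⁻¹ * ((r ^ n * κ) ^ (1 / 2 : ℝ) * L) := fun ρ hρ => by
    have hρ0 : 0 < ρ := hθr.trans_le hρ.1
    have e1 : ‖∫ z in Metric.closedBall (0 : Pt n) 1, fderiv ℝ Φ (y + ρ • z) z‖ ≤
        ∫ z in Metric.closedBall (0 : Pt n) 1, ‖grad Φ (y + ρ • z)‖ := by
      refine norm_integral_le_of_norm_le ?_ ?_
      · exact (hgc.comp (by fun_prop)).continuousOn.integrableOn_compact (isCompact_closedBall _ _)
      · filter_upwards [ae_restrict_mem Metric.isClosed_closedBall.measurableSet] with z hz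
        rw [mem_closedBall_zero_iff] at hz
        refine (ContinuousLinearMap.le_opNorm _ _).trans ?_
        exact (mul_le_of_le_one_right (norm_nonneg _) hz).trans (norm_fderiv_le_norm_grad _ _)
    have e2 := integral_unitClosedBall_comp (fun z => ‖grad Φ z‖) y hρ0
    have e3 : ∫ z in Metric.closedBall y ρ, ‖grad Φ z‖ ≤ ∫ z in Metric.closedBall y r, ‖grad Φ z‖ :=
      setIntegral_mono_set (hgc.continuousOn.integrableOn_compact (isCompact_closedBall _ _))
        (Eventually.of_forall fun z => norm_nonneg _)
        (Metric.closedBall_subset_closedBall hρ.2).eventuallyLE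
    have e4 : ∫ z in Metric.closedBall y r, ‖grad Φ z‖ ≤ (r ^ n * κ) ^ (1 / 2 : ℝ) * L := by
      have hm := hΦ.memLp_grad 2 (volume.restrict (Metric.closedBall y r))
      have := lpNorm_one_le_lpNorm_two hm
      rwa [lpNorm_one_eq_integral_norm hm.1, measureReal_restrict_apply_univ,
        volume_real_closedBall y hr] at this
    refine e1.trans ?_
    rw [e2, smul_eq_mul]
    refine mul_le_mul (inv_anti₀ (by positivity) ?_) (e3.trans e4)
      (integral_nonneg fun z => norm_nonneg _) (by positivity)
    gcongr
    exact hρ.1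
  have hmv := Convex.norm_image_sub_le_of_norm_hasDerivWithin_le
    (fun ρ _ => (hasDerivAt_integral_unitClosedBall hΦ y ρ).hasDerivWithinAt) hbound
    (convex_Icc _ _) (Set.right_mem_Icc.2 hle) (Set.left_mem_Icc.2 hle)
  rw [setAverage_closedBall Φ y hθr, setAverage_closedBall Φ y hr, ← smul_sub, norm_smul,
    Real.norm_of_nonneg (by positivity)]
  refine (mul_le_mul_of_nonneg_left hmv (by positivity)).trans ?_
  have hab : ‖θ * r - r‖ ≤ r := by
    rw [Real.norm_eq_abs, abs_le]; constructor <;> linarith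
  refine (mul_le_mul_of_nonneg_left (mul_le_mul_of_nonneg_left hab (by positivity))
    (by positivity)).trans (le_of_eq ?_)
  have p1 : κ⁻¹ * κ ^ (1 / 2 : ℝ) = κ ^ (-1 / 2 : ℝ) := by
    rw [← Real.rpow_neg_one, ← Real.rpow_add hκ0]; norm_num
  have p2 : (r ^ n)⁻¹ * (r ^ n) ^ (1 / 2 : ℝ) * r = r ^ (1 - (n : ℝ) / 2) := by
    rw [← Real.rpow_natCast, ← Real.rpow_neg hr.le, ← Real.rpow_mul hr.le, ← Real.rpow_add hr]
    nth_rw 2 [← Real.rpow_one r]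
    rw [← Real.rpow_add hr]
    congr 1; ring
  rw [← hκ, ← p1, ← p2, Real.mul_rpow (by positivity) hκ0.le, mul_pow, mul_inv]
  ring

theorem lpNorm_indicator {X E : Type*} [MeasurableSpace X] [NormedAddCommGroup E]
    {μ : Measure X} {p : ℝ≥0∞} {s : Set X} (hs : MeasurableSet s) (f : X → E) :
    lpNorm (s.indicator f) p μ = lpNorm f p (μ.restrict s) := by
  by_cases hf : MemLp f p (μ.restrict s)
  · rw [← toReal_eLpNorm hf.1, ← toReal_eLpNorm ((memLp_indicator_iff_restrict hs).2 hf).1,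
      eLpNorm_indicator_eq_eLpNorm_restrict hs]
  · rw [lpNorm_of_not_memLp hf,
      lpNorm_of_not_memLp fun h => hf ((memLp_indicator_iff_restrict hs).1 h)]

theorem tendsto_setAverage {E X : Type*} [MeasurableSpace X] [NormedAddCommGroup E]
    [NormedSpace ℝ E] {μ : Measure X} [IsFiniteMeasure μ] {p : ℝ≥0∞} (hp : 1 ≤ p) {w : X → E}
    {Φ : ℕ → X → E} (hw : MemLp w p μ) (hΦ : ∀ k, MemLp (Φ k) p μ)
    (hlim : Tendsto (fun k => lpNorm (w - Φ k) p μ) atTop (𝓝 0)) :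
    Tendsto (fun k => ⨍ z, Φ k z ∂μ) atTop (𝓝 (⨍ z, w z ∂μ)) := by
  simp only [average_eq]
  refine Tendsto.const_smul ?_ _
  rw [tendsto_iff_norm_sub_tendsto_zero]
  refine squeeze_zero (fun k => norm_nonneg _) (fun k => ?_)
    (g := fun k => (μ.real Set.univ) ^ ((1 : ℝ≥0∞).toReal⁻¹ - p.toReal⁻¹) *
      lpNorm (w - Φ k) p μ) (by simpa using hlim.const_mul _)
  rw [← integral_sub ((hΦ k).integrable hp) (hw.integrable hp)]
  refine (norm_integral_le_integral_norm _).trans ?_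
  have hsub : MemLp (w - Φ k) p μ := hw.sub (hΦ k)
  refine le_trans (le_of_eq ?_) (lpNorm_le_mul_measure_rpow hp hsub)
  rw [lpNorm_one_eq_integral_norm hsub.1]
  exact integral_congr_ae (Eventually.of_forall fun z => norm_sub_rev _ _)

/-- The approximants and their gradients vanish off `U`, so they converge on all of `ℝⁿ` to the
extensions by zero. The estimate for test functions passes to the limit, for balls that may leave
`U`. -/
theorem IsY0.norm_setAverage_sub_le (hn : 3 ≤ n) {U : Set (Pt n)} (hU : MeasurableSet U)
    {w : Pt n → Vec m} {h : Pt n → Grad m n} (hw : IsY0 U w h)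
    (y : Pt n) {r θ : ℝ} (hr : 0 < r) (hθ : 0 < θ) (hθ1 : θ ≤ 1) :
    ‖(⨍ z in Metric.closedBall y (θ * r), U.indicator w z) -
        ⨍ z in Metric.closedBall y r, U.indicator w z‖ ≤
      (volume.real (Metric.closedBall (0 : Pt n) 1)) ^ (-1 / 2 : ℝ) * (θ ^ n)⁻¹ *
        r ^ (1 - (n : ℝ) / 2) *
          lpNorm (U.indicator h) 2 (volume.restrict (Metric.closedBall y r)) := by
  obtain ⟨Φ, hΦ, h1, h2⟩ := hw.approx
  have hwI : MemLp (U.indicator w) (sobolevExp n) volume :=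
    (memLp_indicator_iff_restrict hU).2 hw.memLp
  have hhI : MemLp (U.indicator h) 2 volume :=
    (memLp_indicator_iff_restrict hU).2 hw.memLp_grad
  have e1 : ∀ k, U.indicator w - Φ k = U.indicator (w - Φ k) := fun k => by
    ext1 z
    by_cases hz : z ∈ U
    · simp [hz]
    · simp [hz, (hΦ k).eq_zero hz]
  have e2 : ∀ k, U.indicator h - grad (Φ k) = U.indicator (h - grad (Φ k)) := fun k => by
    ext1 z
    by_cases hz : z ∈ U
    · simp [hz]
    · simp [hz, (hΦ k).grad_eq_zero hz]
  have t1 : ∀ ρ, Tendsto (fun k => ⨍ z in Metric.closedBall y ρ, Φ k z) atTop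
      (𝓝 (⨍ z in Metric.closedBall y ρ, U.indicator w z)) := fun ρ => by
    refine tendsto_setAverage (one_le_sobolevExp hn) (hwI.restrict _)
      (fun k => (hΦ k).memLp _ _) ?_
    refine squeeze_zero (fun k => lpNorm_nonneg) (fun k => ?_) h1
    rw [← lpNorm_indicator hU, ← e1]
    exact lpNorm_mono_measure Measure.restrict_le_self (hwI.sub ((hΦ k).memLp _ _))
  have t2 : Tendsto (fun k => lpNorm (grad (Φ k)) 2 (volume.restrict (Metric.closedBall y r)))
      atTop (𝓝 (lpNorm (U.indicator h) 2 (volume.restrict (Metric.closedBall y r)))) := by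
    refine tendsto_lpNorm_of_tendsto_sub (by norm_num) (hhI.restrict _)
      (fun k => (hΦ k).memLp_grad _ _) ?_
    refine squeeze_zero (fun k => lpNorm_nonneg) (fun k => ?_) h2
    rw [← lpNorm_indicator hU, ← e2]
    exact lpNorm_mono_measure Measure.restrict_le_self (hhI.sub ((hΦ k).memLp_grad _ _))
  exact le_of_tendsto_of_tendsto' ((t1 _).sub (t1 _)).norm (t2.const_mul _)
    fun k => (hΦ k).norm_setAverage_sub_le y hr hθ hθ1

end Averages

/-! ### Restriction to subdomains and differences of solutions. -/

section Restriction

variable {m n : ℕ} {U V : Set (Pt n)} {u v : Pt n → Vec m} {g h : Pt n → Grad m n}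

theorem setIntegral_eq_of_eq_zero_off (hUV : U ⊆ V) {F : Pt n → ℝ} (hF : ∀ x ∉ U, F x = 0) :
    ∫ x in U, F x = ∫ x in V, F x := by
  rw [setIntegral_eq_integral_of_forall_compl_eq_zero hF,
    setIntegral_eq_integral_of_forall_compl_eq_zero fun x hx => hF x fun h => hx (hUV h)]

theorem HasWeakGrad.mono (hUV : U ⊆ V) (hu : HasWeakGrad V u g) : HasWeakGrad U u g := by
  refine ⟨hu.1.mono_set hUV, hu.2.1.mono_set hUV, fun φ hφ i α => ?_⟩
  rw [setIntegral_eq_of_eq_zero_off hUV fun x hx => by rw [hφ.fderiv_eq_zero hx]; simp,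
    setIntegral_eq_of_eq_zero_off hUV fun x hx => by rw [hφ.eq_zero hx, mul_zero]]
  exact hu.2.2 φ (hφ.mono hUV) i α

theorem MemW12.mono (hUV : U ⊆ V) (hu : MemW12 V u g) : MemW12 U u g :=
  ⟨hu.1.mono hUV, MemLp.mono_set hUV hu.2.1, MemLp.mono_set hUV hu.2.2⟩

theorem IsWeakSol.mono {A : Coeff m n} {f : Pt n → Vec m} (hUV : U ⊆ V)
    (hu : IsWeakSol A V g f) : IsWeakSol A U g f := fun φ hφ => by
  rw [setIntegral_eq_of_eq_zero_off hUV fun x hx => by simp [hφ.grad_eq_zero hx],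
    setIntegral_eq_of_eq_zero_off hUV fun x hx => by simp [hφ.eq_zero hx]]
  exact hu φ (hφ.mono hUV)

/-- The same approximating sequence works, with the compact set `K` replaced by `K ∩ closure U`. -/
theorem VanishesOn.mono {Γ₁ Γ₂ : Set (Pt n)} (hUV : U ⊆ V) (hΓ : Γ₁ ⊆ Γ₂)
    (hu : VanishesOn V Γ₂ u g) : VanishesOn U Γ₁ u g := by
  obtain ⟨⟨h1, h2, h3⟩, φ, hφ, l1, l2⟩ := hu
  have hle := Measure.restrict_mono_set (volume : Measure (Pt n)) hUV
  refine ⟨⟨h1.mono hUV, MemLp.mono_set hUV h2, MemLp.mono_set hUV h3⟩, φ, fun k => ?_,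
    tendsto_of_tendsto_of_tendsto_of_le_of_le tendsto_const_nhds l1 (fun _ => zero_le)
      fun k => eLpNorm_mono_measure _ hle,
    tendsto_of_tendsto_of_tendsto_of_le_of_le tendsto_const_nhds l2 (fun _ => zero_le)
      fun k => eLpNorm_mono_measure _ hle⟩
  obtain ⟨hs, K, hK, hKV, hφK⟩ := hφ k
  refine ⟨hs, K ∩ closure U, hK.inter_right isClosed_closure,
    fun z hz => ⟨hz.2, fun h => (hKV hz.1).2 (hΓ h)⟩, fun z hz hzK => ?_⟩
  exact hφK z (closure_mono hUV hz) fun h => hzK ⟨h, hz⟩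

theorem MemLp.integrable_coord_mul {ι : Type*} [Fintype ι] {μ : Measure (Pt n)} {p q : ℝ≥0∞}
    [p.HolderConjugate q] {w : Pt n → EuclideanSpace ℝ ι} (hw : MemLp w p μ) {φ : Pt n → ℝ}
    (hφ : MemLp φ q μ) (i : ι) : Integrable (fun x => w x i * φ x) μ :=
  (integrable_and_abs_integral_le zero_le_one hw hφ
    ((aestronglyMeasurable_coord hw.1 i).mul hφ.1) (Eventually.of_forall fun x => by
      rw [Pi.mul_apply, abs_mul, one_mul]
      exact mul_le_mul_of_nonneg_right (norm_coord_le _ _) (abs_nonneg _))).1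

theorem MemW12.sub (hu : MemW12 U u g) (hv : MemW12 U v h) : MemW12 U (u - v) (g - h) := by
  refine ⟨⟨hu.1.1.sub hv.1.1, hu.1.2.1.sub hv.1.2.1, fun φ hφ i α => ?_⟩, hu.2.1.sub hv.2.1,
    hu.2.2.sub hv.2.2⟩
  have d1 : MemLp (fun x => fderiv ℝ φ x (EuclideanSpace.single α 1)) 2
      (volume.restrict U) :=
    ((hφ.1.continuous_fderiv (by simp)).clm_apply continuous_const).memLp_of_hasCompactSupport
      (hφ.2.1.fderiv_apply (𝕜 := ℝ) _)
  have d2 : MemLp φ 2 (volume.restrict U) := hφ.memLp 2 _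
  simp only [Pi.sub_apply, PiLp.sub_apply, sub_mul]
  rw [integral_sub (MemLp.integrable_coord_mul hu.2.1 d1 i)
      (MemLp.integrable_coord_mul hv.2.1 d1 i),
    integral_sub (MemLp.integrable_coord_mul hu.2.2 d2 (i, α))
      (MemLp.integrable_coord_mul hv.2.2 d2 (i, α)),
    hu.1.2.2 φ hφ i α, hv.1.2.2 φ hφ i α]
  ring

theorem IsTestOff.sub {Γ : Set (Pt n)} {φ ψ : Pt n → Vec m} (hφ : IsTestOff U Γ φ)
    (hψ : IsTestOff U Γ ψ) : IsTestOff U Γ (φ - ψ) := by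
  obtain ⟨hs, K, hK, hKV, hφK⟩ := hφ
  obtain ⟨hs', K', hK', hKV', hφK'⟩ := hψ
  refine ⟨hs.sub hs', K ∪ K', hK.union hK', Set.union_subset hKV hKV', fun z hz hzK => ?_⟩
  rw [Pi.sub_apply, hφK z hz fun h => hzK (Or.inl h), hφK' z hz fun h => hzK (Or.inr h), sub_zero]

theorem IsTest.isTestOff {Γ : Set (Pt n)} {φ : Pt n → Vec m} (hφ : IsTest U φ)
    (hΓ : Disjoint U Γ) : IsTestOff U Γ φ :=
  ⟨hφ.1, tsupport φ, hφ.2.1, fun _ hz => ⟨subset_closure (hφ.2.2 hz),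
    Set.disjoint_left.1 hΓ (hφ.2.2 hz)⟩, fun _ _ hz => image_eq_zero_of_notMem_tsupport hz⟩

/-- The difference of a function vanishing on `Γ` and a function of zero trace vanishes on `Γ`. -/
theorem VanishesOn.sub_isY0 (hn : 3 ≤ n) {Γ : Set (Pt n)} (hΓ : Disjoint U Γ)
    (hW : HasWeakGrad U (u - v) (g - h)) (hu : VanishesOn U Γ u g) (hv : IsY0 U v h) :
    VanishesOn U Γ (u - v) (g - h) := by
  obtain ⟨⟨h1, h2, h3⟩, φ, hφ, l1, l2⟩ := hu
  obtain ⟨Φ, hΦ, k1, k2⟩ := hv.approx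
  rw [tendsto_lpNorm_iff hv.memLp fun k => (hΦ k).memLp _ _] at k1
  rw [tendsto_lpNorm_iff hv.memLp_grad fun k => (hΦ k).memLp_grad _ _] at k2
  refine ⟨⟨hW, h2.sub hv.memLp, h3.sub hv.memLp_grad⟩, fun k => φ k - Φ k,
    fun k => (hφ k).sub ((hΦ k).isTestOff hΓ), ?_, ?_⟩
  · refine tendsto_of_tendsto_of_tendsto_of_le_of_le tendsto_const_nhds
      (by simpa using l1.add k1) (fun _ => zero_le) fun k => ?_
    have : u - v - (φ k - Φ k) = (u - φ k) - (v - Φ k) := by abel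
    simp only [this]
    exact eLpNorm_sub_le (h2.1.sub (hφ k).1.continuous.aestronglyMeasurable)
      (hv.memLp.1.sub ((hΦ k).memLp 2 _).1) (one_le_sobolevExp hn)
  · refine tendsto_of_tendsto_of_tendsto_of_le_of_le tendsto_const_nhds
      (by simpa using l2.add k2) (fun _ => zero_le) fun k => ?_
    have : g - h - grad (φ k - Φ k) = (g - grad (φ k)) - (h - grad (Φ k)) := by
      ext1 z
      simp only [Pi.sub_apply]
      rw [grad_sub ((hφ k).1.differentiable (by simp) z) ((hΦ k).differentiable z)]
      abel
    simp only [this]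
    exact eLpNorm_sub_le (h3.1.sub (continuous_grad (hφ k).1).aestronglyMeasurable)
      (hv.memLp_grad.1.sub ((hΦ k).memLp_grad 2 _).1) (by norm_num)

theorem IsWeakSol.sub {ν : ℝ} (hν : 0 < ν) {A : Coeff m n} (hA : IsElliptic ν A)
    {f : Pt n → Vec m}
    (hg : MemLp g 2 (volume.restrict U)) (hh : MemLp h 2 (volume.restrict U))
    (h1 : IsWeakSol A U g f) (h2 : IsWeakSol A U h f) : IsWeakSol A U (g - h) 0 := fun φ hφ => by
  have e1 := h1 φ hφ
  rw [← h2 φ hφ] at e1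
  have hφg := hφ.memLp_grad 2 (volume.restrict U)
  change ∫ x in U, energy A x (g x - h x) (grad φ x) = _
  simp only [energy_sub_left]
  rw [integral_sub (integrable_energy_and_abs_le hν hA hg hφg).1
    (integrable_energy_and_abs_le hν hA hh hφg).1]
  simp only [Pi.zero_apply, PiLp.zero_apply, zero_mul, Finset.sum_const_zero, integral_zero]
  exact sub_eq_zero.2 e1

end Restriction

/-! ### Decay of the Dirichlet integral and its iteration. -/

section Decay

variable {m n : ℕ}

theorem disjoint_localDomain_localBdry {Ω : Set (Pt n)} (hΩ : IsOpen Ω) (y : Pt n) (s : ℝ) :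
    Disjoint (localDomain Ω y s) (localBdry Ω y s) :=
  Set.disjoint_left.2 fun _ hz hz' => by
    have := hz'.1
    rw [hΩ.frontier_eq] at this
    exact this.2 hz.1

/-- One step of the decay of the Dirichlet integral for inhomogeneous systems. -/
theorem CondLH.lpNorm_le (hn : 3 ≤ n) {ν : ℝ} (hν : 0 < ν) {A B : Coeff m n}
    (hB : IsElliptic ν B) (hBA : B = A ∨ B = adj A) {S : ℝ} (hS0 : 0 < S)
    (hS : ∀ (U : Set (Pt n)) (φ : Pt n → Vec m), IsTest U φ →
      lpNorm φ (sobolevExp n) (volume.restrict U) ≤ S * lpNorm (grad φ) 2 (volume.restrict U))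
    {Ω : Set (Pt n)} (hΩ : IsOpen Ω) {μ₀ N₁ : ℝ} (hμ₀ : 0 < μ₀) (hN₁ : 0 < N₁) {Rmax : ℝ≥0∞}
    (hLH : CondLH A Ω μ₀ Rmax N₁) {y : Pt n} (hy : y ∈ Ω) {s θ : ℝ} (hs : 0 < s) (hθ : 0 < θ)
    (hθ1 : θ < 1) (hsR : ENNReal.ofReal s < Rmax) {u f : Pt n → Vec m} {g : Pt n → Grad m n}
    (hW : MemW12 (localDomain Ω y s) u g)
    (hf : MemLp f (dualExp n) (volume.restrict (localDomain Ω y s)))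
    (hsol : IsWeakSol B (localDomain Ω y s) g f)
    (hv : VanishesOn (localDomain Ω y s) (localBdry Ω y s) u g) :
    lpNorm g 2 (volume.restrict (localDomain Ω y (θ * s))) ≤
      √N₁ * θ ^ ((n : ℝ) / 2 - 1 + μ₀) * lpNorm g 2 (volume.restrict (localDomain Ω y s)) +
        (√N₁ + 1) * (ν⁻¹ * S) *
          lpNorm f (dualExp n) (volume.restrict (localDomain Ω y s)) := by
  have h3 := three_le_cast hn
  -- Splitting `u = (u - w) + w`: (LH) applies to `u - w`, and the energy estimate controls `w`.
  obtain ⟨w, h, hY, hWh, hbd⟩ := exists_isY0_isWeakSol hn hν hB hS0 hS hf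
  have hw12 : MemW12 (localDomain Ω y s) w h :=
    ⟨hY.hasWeakGrad hn, hY.memLp.mono_exponent (two_le_sobolevExp hn), hY.memLp_grad⟩
  have hsub := hW.sub hw12
  have hzero := hsol.sub hν hB hW.2.2 hw12.2.2 hWh
  have hloc : IsLocalSol A Ω y s (u - w) (g - h) 0 := by
    refine ⟨hsub, ?_, hv.sub_isY0 hn (disjoint_localDomain_localBdry hΩ y s) hsub.1 hY⟩
    rcases hBA with rfl | rfl
    · exact Or.inl hzero
    · exact Or.inr hzero
  have hθs : θ * s < s := mul_lt_of_lt_one_left hs hθ1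
  have hsubset : localDomain Ω y (θ * s) ⊆ localDomain Ω y s :=
    Set.inter_subset_inter_right _ (Metric.ball_subset_ball hθs.le)
  have hdec := hLH y hy s hs hsR _ _ hloc (θ * s) s (by positivity) hθs le_rfl
  rw [mul_div_assoc, div_self hs.ne', mul_one,
    ← lpNorm_sq_eq_integral (MemLp.mono_set hsubset hsub.2.2).1,
    ← lpNorm_sq_eq_integral hsub.2.2.1] at hdec
  -- (LH) concerns squared norms, so its exponent and `N₁` enter below through their halves and
  -- square root.
  have hpow : θ ^ ((n : ℝ) - 2 + 2 * μ₀) = (θ ^ ((n : ℝ) / 2 - 1 + μ₀)) ^ 2 := by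
    rw [← Real.rpow_natCast, ← Real.rpow_mul hθ.le]
    congr 1; push_cast; ring
  have hdec' : lpNorm (g - h) 2 (volume.restrict (localDomain Ω y (θ * s))) ≤
      √N₁ * θ ^ ((n : ℝ) / 2 - 1 + μ₀) *
        lpNorm (g - h) 2 (volume.restrict (localDomain Ω y s)) := by
    refine le_of_sq_le_sq (hdec.trans (le_of_eq ?_))
      (mul_nonneg (by positivity) lpNorm_nonneg)
    rw [mul_pow, mul_pow, Real.sq_sqrt hN₁.le, hpow]
  have t1 : lpNorm g 2 (volume.restrict (localDomain Ω y (θ * s))) ≤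
      lpNorm (g - h) 2 (volume.restrict (localDomain Ω y (θ * s))) +
        lpNorm h 2 (volume.restrict (localDomain Ω y (θ * s))) := by
    simpa using lpNorm_add_le (MemLp.mono_set hsubset hsub.2.2) (g := h) (by norm_num)
  have t2 := lpNorm_mono_set hsubset hw12.2.2
  have t3 := lpNorm_sub_le hW.2.2 (g := h) (by norm_num)
  have hθp : θ ^ ((n : ℝ) / 2 - 1 + μ₀) ≤ 1 :=
    Real.rpow_le_one hθ.le hθ1.le (by linarith)
  have hN := Real.sqrt_nonneg N₁
  have hθp0 : 0 ≤ θ ^ ((n : ℝ) / 2 - 1 + μ₀) := by positivity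
  have hh0 : 0 ≤ lpNorm h 2 (volume.restrict (localDomain Ω y s)) := lpNorm_nonneg
  generalize θ ^ ((n : ℝ) / 2 - 1 + μ₀) = τ at *
  calc lpNorm g 2 (volume.restrict (localDomain Ω y (θ * s)))
      ≤ √N₁ * τ * (lpNorm g 2 (volume.restrict (localDomain Ω y s)) +
          lpNorm h 2 (volume.restrict (localDomain Ω y s))) +
          lpNorm h 2 (volume.restrict (localDomain Ω y s)) := by
        refine t1.trans (add_le_add (hdec'.trans ?_) t2)
        gcongr
    _ = √N₁ * τ * lpNorm g 2 (volume.restrict (localDomain Ω y s)) +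
          (√N₁ * τ + 1) * lpNorm h 2 (volume.restrict (localDomain Ω y s)) := by ring
    _ ≤ √N₁ * τ * lpNorm g 2 (volume.restrict (localDomain Ω y s)) +
          (√N₁ + 1) * (ν⁻¹ * S * lpNorm f (dualExp n) (volume.restrict (localDomain Ω y s))) := by
        gcongr
        exact mul_le_of_le_one_right hN hθp
    _ = _ := by ring

/-- Half of the factor `t` carries the recursion; the other half absorbs the source, because `D t^k
= (t/2) · t^k · (2D/t)`. -/
theorem le_geometric_of_le_half_mul_add {X : ℕ → ℝ} {c t D : ℝ} (ht : 0 < t) (hct : c ≤ t / 2)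
    (hD : 0 ≤ D) (hX : ∀ k, 0 ≤ X k) (h : ∀ k, X (k + 1) ≤ c * X k + D * t ^ k) (k : ℕ) :
    X k ≤ t ^ k * (X 0 + 2 * D / t) := by
  induction k with
  | zero => simp; positivity
  | succ k ih =>
    have h1 : c * X k ≤ t / 2 * (t ^ k * (X 0 + 2 * D / t)) :=
      (mul_le_mul_of_nonneg_right hct (hX k)).trans (mul_le_mul_of_nonneg_left ih (by positivity))
    have h2 : D * t ^ k = t / 2 * (t ^ k * (2 * D / t)) := by field_simp
    have h3 : 0 ≤ t / 2 * (t ^ k * X 0) := mul_nonneg (by positivity)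
      (mul_nonneg (by positivity) (hX 0))
    calc X (k + 1) ≤ _ := h k
      _ ≤ t / 2 * (t ^ k * (X 0 + 2 * D / t)) + t / 2 * (t ^ k * (2 * D / t)) := by
          rw [h2]; gcongr
      _ ≤ t ^ (k + 1) * (X 0 + 2 * D / t) := by rw [pow_succ]; linarith

/-- A pointwise bound from the decay of the Dirichlet integral, in the manner of Morrey. -/
theorem norm_le_of_average_decay {a : ℕ → Vec m} {l : Vec m} {X : ℕ → ℝ} {N C c D s θ γ δ : ℝ}
    (hθ : 0 < θ) (hθ1 : θ < 1) (hs : 0 < s) (hγ : 0 < γ) (hγδ : γ ≤ δ) (hC : 0 ≤ C) (hD : 0 ≤ D)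
    (hc : c ≤ θ ^ (N / 2 - 1 + γ) / 2) (hX : ∀ k, 0 ≤ X k)
    (havg : ∀ k, ‖a (k + 1) - a k‖ ≤ C * (θ ^ k * s) ^ (1 - N / 2) * X k)
    (hdec : ∀ k, X (k + 1) ≤ c * X k + D * (θ ^ k * s) ^ (N / 2 - 1 + δ))
    (hlim : Tendsto a atTop (𝓝 l)) :
    ‖l‖ ≤ ‖a 0‖ + C * s ^ (1 - N / 2) *
      (X 0 + 2 * (D * s ^ (N / 2 - 1 + δ)) / θ ^ (N / 2 - 1 + γ)) / (1 - θ ^ γ) := by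
  set t := θ ^ (N / 2 - 1 + γ) with ht
  have ht0 : 0 < t := Real.rpow_pos_of_pos hθ _
  have hpow : ∀ (k : ℕ) (e : ℝ), (θ ^ k * s) ^ e = (θ ^ e) ^ k * s ^ e := fun k e => by
    rw [Real.mul_rpow (by positivity) hs.le, ← Real.rpow_natCast, ← Real.rpow_mul hθ.le,
      mul_comm (k : ℝ) e, Real.rpow_mul hθ.le, Real.rpow_natCast]
  have hgeo := le_geometric_of_le_half_mul_add (X := X) (c := c) (D := D * s ^ (N / 2 - 1 + δ))
    ht0 hc (by positivity) hX fun k => by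
      refine (hdec k).trans ?_
      rw [hpow k (N / 2 - 1 + δ), mul_comm ((θ ^ (N / 2 - 1 + δ)) ^ k), ← mul_assoc]
      have hle : θ ^ (N / 2 - 1 + δ) ≤ t :=
        Real.rpow_le_rpow_of_exponent_ge hθ hθ1.le (by linarith)
      gcongr
  set M := X 0 + 2 * (D * s ^ (N / 2 - 1 + δ)) / t with hM
  have hstep : ∀ k, dist (a k) (a (k + 1)) ≤ C * s ^ (1 - N / 2) * M * (θ ^ γ) ^ k := fun k => by
    rw [dist_comm, dist_eq_norm]
    refine (havg k).trans ((mul_le_mul_of_nonneg_left (hgeo k) (by positivity)).trans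
      (le_of_eq ?_))
    -- The growing factor `(θ^k s)^(1-N/2)` cancels all of `t^k` except `θ^(γk)`, which leaves a
    -- summable series.
    have h1 : θ ^ (1 - N / 2) * t = θ ^ γ := by
      rw [ht, ← Real.rpow_add hθ]; congr 1; ring
    rw [hpow, ← h1, mul_pow]
    ring
  have h := dist_le_of_le_geometric_of_tendsto₀ (θ ^ γ) _ (Real.rpow_lt_one hθ.le hθ1 hγ) hstep hlim
  rw [dist_eq_norm] at h
  have h2 := norm_le_norm_add_norm_sub' l (a 0)
  rw [norm_sub_rev] at h2
  linarith

theorem exists_ratio {c ε : ℝ} (hc : 0 ≤ c) (hε : 0 < ε) :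
    ∃ θ : ℝ, 0 < θ ∧ θ < 1 ∧ c * θ ^ ε ≤ 1 / 2 := by
  have h0 : 0 < (2 * (c + 1))⁻¹ := by positivity
  have h1 : (2 * (c + 1))⁻¹ < 1 := inv_lt_one_of_one_lt₀ (by linarith)
  refine ⟨(2 * (c + 1))⁻¹ ^ ε⁻¹, by positivity,
    Real.rpow_lt_one h0.le h1 (inv_pos.2 hε), ?_⟩
  rw [← Real.rpow_mul h0.le, inv_mul_cancel₀ hε.ne', Real.rpow_one, ← div_eq_mul_inv,
    div_le_div_iff₀ (by positivity) (by norm_num)]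
  linarith

/-- Hölder's inequality on a set of diameter comparable to `ρ`. -/
theorem exists_lpNorm_dualExp_le (hn : 3 ≤ n) (m : ℕ) {p : ℝ≥0∞} (hp : (n : ℝ≥0∞) / 2 < p) :
    ∃ C : ℝ, 0 ≤ C ∧ ∀ (U : Set (Pt n)) (z : Pt n) (ρ : ℝ), 0 < ρ → U ⊆ Metric.ball z ρ →
      ∀ f : Pt n → Vec m, MemLp f p (volume.restrict U) →
        MemLp f (dualExp n) (volume.restrict U) ∧
        lpNorm f (dualExp n) (volume.restrict U) ≤
          C * ρ ^ ((n : ℝ) / 2 - 1 + (2 - n * (p⁻¹).toReal)) * lpNorm f p (volume.restrict U) := by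
  have h3 := three_le_cast hn
  have hδ := two_sub_pos_of_lt hn hp
  set κ := volume.real (Metric.closedBall (0 : Pt n) 1) with hκ
  have hκ0 : 0 < κ := volume_real_unitClosedBall_pos n
  refine ⟨κ ^ (1 / 2 + 1 / (n : ℝ) - p.toReal⁻¹), by positivity, fun U z ρ hρ hU f hf => ?_⟩
  have : IsFiniteMeasure (volume.restrict U) :=
    ⟨by rw [Measure.restrict_apply_univ]; exact (measure_mono hU).trans_lt measure_ball_lt_top⟩
  refine ⟨hf.mono_exponent (dualExp_le_of_lt hn hp), ?_⟩
  have h1 := lpNorm_le_mul_measure_rpow (dualExp_le_of_lt hn hp) hf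
  have hvol : (volume.restrict U).real Set.univ ≤ ρ ^ n * κ := by
    rw [measureReal_restrict_apply_univ, hκ, ← volume_real_closedBall z hρ]
    exact measureReal_mono (hU.trans Metric.ball_subset_closedBall) measure_closedBall_lt_top.ne
  rw [toReal_dualExp_inv hn] at h1
  rw [ENNReal.toReal_inv] at hδ ⊢
  -- The volume power from Hölder's inequality, read as a power of the radius: `n(1/2 + 1/n - 1/p) =
  -- n/2 - 1 + δ`.
  have hexp : (n : ℝ) * (1 / 2 + 1 / (n : ℝ) - p.toReal⁻¹) =
      (n : ℝ) / 2 - 1 + (2 - n * p.toReal⁻¹) := by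
    field_simp; ring
  have hexp0 : 0 ≤ 1 / 2 + 1 / (n : ℝ) - p.toReal⁻¹ := by
    refine nonneg_of_mul_nonneg_right (a := (n : ℝ)) ?_ (by linarith)
    rw [hexp]; linarith
  refine h1.trans (mul_le_mul_of_nonneg_right ?_ lpNorm_nonneg)
  refine (Real.rpow_le_rpow measureReal_nonneg hvol hexp0).trans (le_of_eq ?_)
  rw [Real.mul_rpow (by positivity) hκ0.le, ← Real.rpow_natCast, ← Real.rpow_mul hρ.le, hexp,
    mul_comm]

theorem norm_setAverage_closedBall_le {W : Pt n → Vec m} (hW : MemLp W 2 volume) (y : Pt n)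
    {ρ : ℝ} (hρ : 0 < ρ) :
    ‖⨍ z in Metric.closedBall y ρ, W z‖ ≤
      (volume.real (Metric.closedBall (0 : Pt n) 1)) ^ (-1 / 2 : ℝ) * ρ ^ (-(n : ℝ) / 2) *
        lpNorm W 2 volume := by
  set κ := volume.real (Metric.closedBall (0 : Pt n) 1) with hκ
  have hκ0 : 0 < κ := volume_real_unitClosedBall_pos n
  have hWr := hW.restrict (Metric.closedBall y ρ)
  have h1 := lpNorm_one_le_lpNorm_two hWr
  rw [lpNorm_one_eq_integral_norm hWr.1, measureReal_restrict_apply_univ,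
    volume_real_closedBall y hρ, ← hκ] at h1
  have h2 := lpNorm_mono_measure Measure.restrict_le_self hW (μ := volume.restrict
    (Metric.closedBall y ρ))
  have hV : 0 < ρ ^ n * κ := by positivity
  rw [setAverage_eq, norm_smul, volume_real_closedBall y hρ, ← hκ, norm_inv,
    Real.norm_of_nonneg hV.le]
  calc (ρ ^ n * κ)⁻¹ * ‖∫ z in Metric.closedBall y ρ, W z‖
      ≤ (ρ ^ n * κ)⁻¹ * ((ρ ^ n * κ) ^ (1 / 2 : ℝ) * lpNorm W 2 volume) := by
        gcongr
        refine (norm_integral_le_integral_norm _).trans (h1.trans ?_)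
        gcongr
    _ = κ ^ (-1 / 2 : ℝ) * ρ ^ (-(n : ℝ) / 2) * lpNorm W 2 volume := by
        have : (ρ ^ n * κ)⁻¹ * (ρ ^ n * κ) ^ (1 / 2 : ℝ) =
            κ ^ (-1 / 2 : ℝ) * ρ ^ (-(n : ℝ) / 2) := by
          rw [← Real.rpow_neg_one, ← Real.rpow_add hV, Real.mul_rpow (by positivity) hκ0.le,
            ← Real.rpow_natCast, ← Real.rpow_mul hρ.le, mul_comm]
          have e : (n : ℝ) * (-1 + 1 / 2) = -(n : ℝ) / 2 := by ring
          rw [e]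
          norm_num
        rw [← this]; ring

end Decay

/-! ### The pointwise bound. -/

section Boundedness

variable {m n : ℕ}

theorem outer_zero_right (v : Vec m) : outer v (0 : Pt n →L[ℝ] ℝ) = 0 := by
  ext ⟨i, α⟩
  simp [outer_apply]

/-- Averages are taken over closed balls and local domains over open ones; the sphere between them
is null. -/
theorem closedBall_ae_eq_ball (hn : 3 ≤ n) (y : Pt n) (r : ℝ) :
    Metric.closedBall y r =ᵐ[volume] Metric.ball y r := by
  have : Nonempty (Fin n) := ⟨⟨0, by omega⟩⟩
  refine (Metric.ball_subset_closedBall.eventuallyLE.antisymm ?_).symm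
  rw [ae_le_set, Metric.closedBall_sdiff_ball]
  exact Measure.addHaar_sphere _ _ _

theorem lpNorm_indicator_cutoff_le (hn : 3 ≤ n) {Ω : Set (Pt n)} (hΩ : IsOpen Ω) {x y : Pt n}
    {R r : ℝ} {u : Pt n → Vec m} {g : Pt n → Grad m n} {η : Pt n → ℝ}
    (hη1 : ∀ z ∈ Metric.ball x (3 / 4 * R), η z = 1) (hR : 0 < R)
    (hr : Metric.ball y r ⊆ Metric.ball x (3 / 4 * R))
    (hg : MemLp g 2 (volume.restrict (localDomain Ω x R))) :
    lpNorm ((localDomain Ω x R).indicator fun z => η z • g z + outer (u z) (fderiv ℝ η z)) 2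
      (volume.restrict (Metric.closedBall y r)) ≤
        lpNorm g 2 (volume.restrict (localDomain Ω y r)) := by
  have hbR : Metric.ball y r ⊆ Metric.ball x R :=
    hr.trans (Metric.ball_subset_ball (by linarith))
  have hsub : localDomain Ω y r ⊆ localDomain Ω x R := Set.inter_subset_inter_right _ hbR
  rw [Measure.restrict_congr_set (closedBall_ae_eq_ball hn y r)]
  have hm := (isOpen_localDomain hΩ y r).measurableSet
  have hmem : MemLp ((localDomain Ω y r).indicator g) 2 volume :=
    (memLp_indicator_iff_restrict hm).2 (MemLp.mono_set hsub hg)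
  have hle : lpNorm ((localDomain Ω y r).indicator g) 2 (volume.restrict (Metric.ball y r)) ≤
      lpNorm g 2 (volume.restrict (localDomain Ω y r)) := by
    rw [← lpNorm_indicator hm]
    exact lpNorm_mono_measure Measure.restrict_le_self hmem
  refine (lpNorm_mono_ae (hmem.restrict (Metric.ball y r)) ?_).trans hle
  filter_upwards [ae_restrict_mem Metric.isOpen_ball.measurableSet] with z hz
  by_cases hzΩ : z ∈ Ω
  · have h1 : z ∈ localDomain Ω x R := ⟨hzΩ, hbR hz⟩
    have h2 : z ∈ localDomain Ω y r := ⟨hzΩ, hz⟩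
    have h3 : η =ᶠ[𝓝 z] fun _ => 1 := by
      filter_upwards [Metric.isOpen_ball.mem_nhds (hr hz)] with z' hz' using hη1 z' hz'
    rw [Set.indicator_of_mem h1, Set.indicator_of_mem h2, h3.fderiv_eq, hη1 z (hr hz),
      fderiv_fun_const, Pi.zero_apply, outer_zero_right, one_smul, add_zero]
  · rw [Set.indicator_of_notMem fun h => hzΩ h.1]
    simp

/-- The operator of the equation is called `B`, so that `L` and `ᵗL` are handled together under the
same condition (LH). The constant precedes the coefficients and the domain. -/
theorem exists_ae_norm_le (hn : 3 ≤ n) (m : ℕ) {ν : ℝ} (hν : 0 < ν) {μ₀ : ℝ} (hμ₀ : 0 < μ₀)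
    {N₁ : ℝ} (hN₁ : 0 < N₁) {p : ℝ≥0∞} (hp : (n : ℝ≥0∞) / 2 < p) :
    ∃ C : ℝ, 0 < C ∧ ∀ (A B : Coeff m n) (Ω : Set (Pt n)) (Rmax : ℝ≥0∞),
      IsElliptic ν B → (B = A ∨ B = adj A) → IsOpen Ω → CondLH A Ω μ₀ Rmax N₁ →
      ∀ (x : Pt n) (R : ℝ), 0 < R → ENNReal.ofReal R < Rmax →
      ∀ (f u : Pt n → Vec m) (g : Pt n → Grad m n),
        MemLp f p (volume.restrict (localDomain Ω x R)) →
        MemW12 (localDomain Ω x R) u g → IsWeakSol B (localDomain Ω x R) g f →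
        VanishesOn (localDomain Ω x R) (localBdry Ω x R) u g →
        ∀ᵐ y ∂(volume.restrict (localDomain Ω x (R / 2))), ‖u y‖ ≤
          C * (R ^ (-(n : ℝ) / 2) * lpNorm u 2 (volume.restrict (localDomain Ω x R)) +
            R ^ (2 - (n : ℝ) * (p⁻¹).toReal) *
              lpNorm f p (volume.restrict (localDomain Ω x R))) := by
  have h3 := three_le_cast hn
  have hδ := two_sub_pos_of_lt hn hp
  obtain ⟨Cf, hCf, hHolder⟩ := exists_lpNorm_dualExp_le hn m hp
  set δ := 2 - (n : ℝ) * (p⁻¹).toReal with hδdef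
  -- The decay rate must be strictly below `μ₀`, leaving a power `θ^(μ₀-γ)` to absorb `√N₁`, and at
  -- most the rate `δ` of the source.
  set γ := min μ₀ δ / 2 with hγdef
  have hγ : 0 < γ := by rw [hγdef]; have := lt_min hμ₀ hδ; positivity
  have hγμ : γ < μ₀ := by
    rw [hγdef]; have := lt_min hμ₀ hδ; have := min_le_left μ₀ δ; linarith
  have hγδ : γ ≤ δ := by
    rw [hγdef]; have := lt_min hμ₀ hδ; have := min_le_right μ₀ δ; linarith
  obtain ⟨θ, hθ, hθ1, hθc⟩ := exists_ratio (Real.sqrt_nonneg N₁) (sub_pos.2 hγμ)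
  obtain ⟨S, hS0, hS⟩ := exists_sobolev_const (n := n) m hn
  obtain ⟨Cc, hCc, hcut⟩ := exists_cutoff_const n
  set κ := volume.real (Metric.closedBall (0 : Pt n) 1) with hκ
  have hκ0 : 0 < κ := volume_real_unitClosedBall_pos n
  set T := ‖(toGrad : (Pt n →L[ℝ] Vec m) →L[ℝ] Grad m n)‖ with hT
  have hT0 : 0 ≤ T := by rw [hT]; positivity
  set t := θ ^ ((n : ℝ) / 2 - 1 + γ) with ht
  have ht0 : 0 < t := Real.rpow_pos_of_pos hθ _
  have hq : 0 < 1 - θ ^ γ := sub_pos.2 (Real.rpow_lt_one hθ.le hθ1 hγ)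
  have hc : √N₁ * θ ^ ((n : ℝ) / 2 - 1 + μ₀) ≤ t / 2 := by
    have e : θ ^ ((n : ℝ) / 2 - 1 + μ₀) = θ ^ (μ₀ - γ) * t := by
      rw [ht, ← Real.rpow_add hθ]; congr 1; ring
    rw [e, ← mul_assoc]
    refine (mul_le_mul_of_nonneg_right hθc ht0.le).trans (le_of_eq (by ring))
  set Cav := κ ^ (-1 / 2 : ℝ) * (θ ^ n)⁻¹ with hCav
  have hCav0 : 0 ≤ Cav := by positivity
  -- `c1` comes from the first average, `c2` and `c3` from Caccioppoli's inequality, `c4` from the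
  -- source in each decay step, and `c5` from summing the geometric series. The `1` added below only
  -- serves positivity.
  set c1 := κ ^ (-1 / 2 : ℝ) * 4⁻¹ ^ (-(n : ℝ) / 2) with hc1
  set c2 := (ν⁻¹ * (2 * ν⁻¹) + 1) * (T * Cc) with hc2
  set c3 := ν⁻¹ * (2 * S) * Cf with hc3
  set c4 := (√N₁ + 1) * (ν⁻¹ * S) * Cf with hc4
  set c5 := Cav * 4⁻¹ ^ (1 - (n : ℝ) / 2) / (1 - θ ^ γ) with hc5
  refine ⟨c1 + c5 * c2 + c5 * (c3 + 2 * c4 / t) + 1, by positivity,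
    fun A B Ω Rmax hB hBA hΩ hLH x R hR hRmax f u g hf hW hsol hv => ?_⟩
  set U := localDomain Ω x R with hU
  have hUm : MeasurableSet U := (isOpen_localDomain hΩ x R).measurableSet
  set P := lpNorm u 2 (volume.restrict U) with hP
  set K := lpNorm f p (volume.restrict U) with hK
  have hP0 : 0 ≤ P := lpNorm_nonneg
  have hK0 : 0 ≤ K := lpNorm_nonneg
  obtain ⟨η, hη, hη0, hηle, hη1, hηD⟩ := hcut x R hR
  have hY := hv.cutoff hn hΩ hη
  obtain ⟨hfq, hfle⟩ := hHolder U x R hR localDomain_subset_ball f hf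
  set W := U.indicator fun z => η z • u z with hWdef
  have hW1 : MemLp W (sobolevExp n) volume := (memLp_indicator_iff_restrict hUm).2 hY.memLp
  have hW2 : MemLp W 2 volume :=
    (memLp_indicator_iff_restrict hUm).2 (hY.memLp.mono_exponent (two_le_sobolevExp hn))
  have hW2P : lpNorm W 2 volume ≤ P := by
    rw [hWdef, lpNorm_indicator hUm]
    refine lpNorm_mono_ae hW.2.1 (Eventually.of_forall fun z => ?_)
    rw [norm_smul, Real.norm_of_nonneg (hη0 z)]
    exact mul_le_of_le_one_left (norm_nonneg _) (hηle z)
  have hcacc : lpNorm (fun z => η z • g z) 2 (volume.restrict U) ≤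
      c2 * (R⁻¹ * P) + c3 * (R ^ ((n : ℝ) / 2 - 1 + δ) * K) := by
    have h1 := hv.caccioppoli hn hν hB hS0 hS hΩ hfq hsol hη hη0 hηle
    have h2 : lpNorm (fun z => outer (u z) (fderiv ℝ η z)) 2 (volume.restrict U) ≤
        T * (Cc / R) * P := by
      refine lpNorm_le_mul_of_ae_le (by positivity) hW.2.1 (Eventually.of_forall fun z => ?_)
      refine (norm_outer_le _ _).trans ?_
      gcongr
      exact hηD z
    have hν' : 0 < ν⁻¹ := inv_pos.2 hν
    calc _ ≤ _ := h1
      _ ≤ ν⁻¹ * (2 * S * (Cf * R ^ ((n : ℝ) / 2 - 1 + δ) * K) +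
            2 * ν⁻¹ * (T * (Cc / R) * P)) + T * (Cc / R) * P := by gcongr
      _ = _ := by rw [hc2, hc3]; ring
  -- Lebesgue differentiation is applied to the extension `W` on `ℝⁿ`. Near `y ∈ Ω_{R/2}(x)` its
  -- balls lie in the plateau of `η`, and there `W y = u y`.
  have hLeb := IsUnifLocDoublingMeasure.ae_tendsto_average (volume : Measure (Pt n))
    (hW1.locallyIntegrable (one_le_sobolevExp hn)) 1
  filter_upwards [ae_restrict_of_ae hLeb,
    ae_restrict_mem (isOpen_localDomain hΩ x (R / 2)).measurableSet] with y hyL hy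
  have hyR : dist y x < R / 2 := hy.2
  have hs : 0 < R / 4 := by positivity
  have hrk : ∀ k : ℕ, 0 < θ ^ k * (R / 4) := fun k => by positivity
  have hrk' : ∀ k : ℕ, θ ^ k * (R / 4) ≤ R / 4 := fun k =>
    mul_le_of_le_one_left hs.le (pow_le_one₀ hθ.le hθ1.le)
  have hball : ∀ k : ℕ, Metric.ball y (θ ^ k * (R / 4)) ⊆ Metric.ball x (3 / 4 * R) := fun k =>
    Metric.ball_subset_ball' (by linarith [hrk' k])
  have hballR : Metric.ball x (3 / 4 * R) ⊆ Metric.ball x R :=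
    Metric.ball_subset_ball (by linarith)
  have hsubU : ∀ k : ℕ, localDomain Ω y (θ ^ k * (R / 4)) ⊆ U := fun k =>
    Set.inter_subset_inter_right _ ((hball k).trans hballR)
  have hlim : Tendsto (fun k : ℕ => ⨍ z in Metric.closedBall y (θ ^ k * (R / 4)), W z) atTop
      (𝓝 (W y)) := by
    refine hyL (fun _ => y) (fun k : ℕ => θ ^ k * (R / 4)) ?_
      (Eventually.of_forall fun k => Metric.mem_closedBall_self (by linarith [hrk k]))
    refine tendsto_nhdsWithin_iff.2 ⟨?_, Eventually.of_forall fun k => hrk k⟩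
    simpa using (tendsto_pow_atTop_nhds_zero_of_lt_one hθ.le hθ1).mul_const (R / 4)
  have hmain := norm_le_of_average_decay (N := n)
    (a := fun k : ℕ => ⨍ z in Metric.closedBall y (θ ^ k * (R / 4)), W z)
    (X := fun k => lpNorm g 2 (volume.restrict (localDomain Ω y (θ ^ k * (R / 4)))))
    (C := Cav) (D := c4 * K) hθ hθ1 hs hγ hγδ hCav0 (by positivity) hc (fun k => lpNorm_nonneg)
    (fun k => by
      have h1 := hY.norm_setAverage_sub_le hn hUm y (hrk k) hθ hθ1.le
      have h2 : θ ^ (k + 1) * (R / 4) = θ * (θ ^ k * (R / 4)) := by ring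
      simp only [h2]
      refine h1.trans (mul_le_mul_of_nonneg_left ?_ (by have := hrk k; positivity))
      exact lpNorm_indicator_cutoff_le hn hΩ hη1 hR (hball k) hW.2.2)
    (fun k => by
      have h2 : θ ^ (k + 1) * (R / 4) = θ * (θ ^ k * (R / 4)) := by ring
      have hfk := MemLp.mono_set (hsubU k) hf
      obtain ⟨f1, f2⟩ := hHolder _ y _ (hrk k) localDomain_subset_ball f hfk
      have hbd : localBdry Ω y (θ ^ k * (R / 4)) ⊆ localBdry Ω x R :=
        Set.inter_subset_inter_right _ ((hball k).trans hballR)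
      have h1 := hLH.lpNorm_le hn hν hB hBA hS0 hS hΩ hμ₀ hN₁ hy.1 (hrk k) hθ hθ1
        (lt_of_le_of_lt (ENNReal.ofReal_le_ofReal (by linarith [hrk' k])) hRmax)
        (hW.mono (hsubU k)) f1 (hsol.mono (hsubU k)) (hv.mono (hsubU k) hbd)
      simp only [h2]
      refine h1.trans (add_le_add le_rfl ?_)
      have hν' : 0 < ν⁻¹ := inv_pos.2 hν
      have hk0 := hrk k
      calc _ ≤ (√N₁ + 1) * (ν⁻¹ * S) * (Cf * (θ ^ k * (R / 4)) ^ ((n : ℝ) / 2 - 1 + δ) * K) := by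
            gcongr
            refine f2.trans ?_
            gcongr
            exact lpNorm_mono_set (hsubU k) hf
        _ = _ := by rw [hc4]; ring)
    hlim
  have hyU : y ∈ U := ⟨hy.1, lt_trans hyR (by linarith)⟩
  have hWy : W y = u y := by
    rw [hWdef, Set.indicator_of_mem hyU, hη1 y (lt_trans hyR (by linarith)), one_smul]
  rw [hWy] at hmain
  -- On the initial ball `η = 1`, so the Dirichlet norm of `u` is part of the norm of `ηg` bounded
  -- by Caccioppoli's inequality.
  have hX0 : lpNorm g 2 (volume.restrict (localDomain Ω y (θ ^ 0 * (R / 4)))) ≤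
      c2 * (R⁻¹ * P) + c3 * (R ^ ((n : ℝ) / 2 - 1 + δ) * K) := by
    refine le_trans ?_ hcacc
    have hηg : MemLp (fun z => η z • g z) 2 (volume.restrict U) :=
      hW.2.2.of_le (hη.1.continuous.aestronglyMeasurable.smul hW.2.2.1)
        (Eventually.of_forall fun z => by
          rw [norm_smul, Real.norm_of_nonneg (hη0 z)]
          exact mul_le_of_le_one_left (norm_nonneg _) (hηle z))
    refine le_trans ?_ (lpNorm_mono_set (hsubU 0) hηg)
    refine lpNorm_mono_ae (MemLp.mono_set (hsubU 0) hηg) ?_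
    filter_upwards [ae_restrict_mem (isOpen_localDomain hΩ y _).measurableSet] with z hz
    rw [hη1 z (hball 0 hz.2), one_smul]
  have ha0 : ‖⨍ z in Metric.closedBall y (θ ^ 0 * (R / 4)), W z‖ ≤
      c1 * (R ^ (-(n : ℝ) / 2) * P) := by
    refine (norm_setAverage_closedBall_le hW2 y (hrk 0)).trans ?_
    rw [pow_zero, one_mul, div_eq_mul_inv R, Real.mul_rpow hR.le (by norm_num)]
    calc _ ≤ κ ^ (-1 / 2 : ℝ) * (R ^ (-(n : ℝ) / 2) * 4⁻¹ ^ (-(n : ℝ) / 2)) * P := by gcongr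
      _ = _ := by rw [hc1]; ring
  have hpow1 : (R / 4) ^ (1 - (n : ℝ) / 2) = R ^ (1 - (n : ℝ) / 2) * 4⁻¹ ^ (1 - (n : ℝ) / 2) := by
    rw [div_eq_mul_inv, Real.mul_rpow hR.le (by norm_num)]
  have hpow2 : (R / 4) ^ ((n : ℝ) / 2 - 1 + δ) ≤ R ^ ((n : ℝ) / 2 - 1 + δ) :=
    Real.rpow_le_rpow hs.le (by linarith) (by linarith)
  have e1 : R ^ (1 - (n : ℝ) / 2) * R⁻¹ = R ^ (-(n : ℝ) / 2) := by
    rw [← Real.rpow_neg_one R, ← Real.rpow_add hR]; congr 1; ring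
  have e2 : R ^ (1 - (n : ℝ) / 2) * R ^ ((n : ℝ) / 2 - 1 + δ) = R ^ δ := by
    rw [← Real.rpow_add hR]; congr 1; ring
  have hc5' : 0 ≤ c5 := by positivity
  have hν' : 0 < ν⁻¹ := inv_pos.2 hν
  have hc1' : 0 ≤ c1 := by positivity
  have hc2' : 0 ≤ c2 := by positivity
  have hc3' : 0 ≤ c3 := by positivity
  have hc4' : 0 ≤ c4 := by positivity
  set Q := R ^ ((n : ℝ) / 2 - 1 + δ) with hQ
  calc ‖u y‖ ≤ _ := hmain
    _ ≤ c1 * (R ^ (-(n : ℝ) / 2) * P) +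
        Cav * (R ^ (1 - (n : ℝ) / 2) * 4⁻¹ ^ (1 - (n : ℝ) / 2)) *
          (c2 * (R⁻¹ * P) + c3 * (Q * K) + 2 * (c4 * K * Q) / t) / (1 - θ ^ γ) := by
        rw [hpow1]
        gcongr
    _ = c1 * (R ^ (-(n : ℝ) / 2) * P) + c5 * c2 * (R ^ (1 - (n : ℝ) / 2) * R⁻¹ * P) +
        c5 * (c3 + 2 * c4 / t) * (R ^ (1 - (n : ℝ) / 2) * Q * K) := by
        rw [hc5]; ring
    _ = (c1 + c5 * c2) * (R ^ (-(n : ℝ) / 2) * P) + c5 * (c3 + 2 * c4 / t) * (R ^ δ * K) := by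
        rw [e1, e2]; ring
    _ ≤ _ := by
        have z1 : 0 ≤ R ^ (-(n : ℝ) / 2) * P := by positivity
        have z2 : 0 ≤ R ^ δ * K := by positivity
        have z3 : 0 ≤ c5 * (c3 + 2 * c4 / t) := by positivity
        have z4 : 0 ≤ c5 * c2 := by positivity
        have k1 : c1 + c5 * c2 ≤ c1 + c5 * c2 + c5 * (c3 + 2 * c4 / t) + 1 := by linarith
        have k2 : c5 * (c3 + 2 * c4 / t) ≤ c1 + c5 * c2 + c5 * (c3 + 2 * c4 / t) + 1 := by
          linarith
        exact (add_le_add (mul_le_mul_of_nonneg_right k1 z1)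
          (mul_le_mul_of_nonneg_right k2 z2)).trans_eq (mul_add _ _ _).symm

end Boundedness

end EllipticSystem

theorem mainTheorem5 (n m : ℕ) (hn : 3 ≤ n) (ν : ℝ) (hν : 0 < ν) (hν1 : ν ≤ 1)
    (μ₀ : ℝ) (hμ₀ : 0 < μ₀) (hμ₀1 : μ₀ ≤ 1) (N₁ : ℝ) (hN₁ : 0 < N₁) :
    (∀ p : ℝ≥0∞, (n : ℝ≥0∞) / 2 < p →
      ∃ C : ℝ, 0 < C ∧
        ∀ (A : Coeff m n) (Ω : Set (Pt n)) (Rmax : ℝ≥0∞),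
          IsElliptic ν A → IsOpen Ω → IsConnected Ω → 0 < Rmax → CondLH A Ω μ₀ Rmax N₁ →
          ∀ x ∈ Ω, ∀ R : ℝ, 0 < R → ENNReal.ofReal R < Rmax →
            ∀ f : Pt n → Vec m, MemLp f p (volume.restrict (localDomain Ω x R)) →
              ∀ (u : Pt n → Vec m) (g : Pt n → Grad m n), IsLocalSol A Ω x R u g f →
                eLpNorm u ∞ (volume.restrict (localDomain Ω x (R / 2))) ≤
                  ENNReal.ofReal C *
                    (ENNReal.ofReal (R ^ (-(n : ℝ) / 2)) *
                        eLpNorm u 2 (volume.restrict (localDomain Ω x R)) +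
                      ENNReal.ofReal (R ^ (2 - (n : ℝ) * (p⁻¹).toReal)) *
                        eLpNorm f p (volume.restrict (localDomain Ω x R)))) ∧
    (∃ N₀ : ℝ, 0 < N₀ ∧
      ∀ (A : Coeff m n) (Ω : Set (Pt n)) (Rmax : ℝ≥0∞),
        IsElliptic ν A → IsOpen Ω → IsConnected Ω → 0 < Rmax → CondLH A Ω μ₀ Rmax N₁ →
        CondLB A Ω Rmax N₀) := by
  have first : ∀ p : ℝ≥0∞, (n : ℝ≥0∞) / 2 < p →
      ∃ C : ℝ, 0 < C ∧
        ∀ (A : Coeff m n) (Ω : Set (Pt n)) (Rmax : ℝ≥0∞),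
          IsElliptic ν A → IsOpen Ω → IsConnected Ω → 0 < Rmax → CondLH A Ω μ₀ Rmax N₁ →
          ∀ x ∈ Ω, ∀ R : ℝ, 0 < R → ENNReal.ofReal R < Rmax →
            ∀ f : Pt n → Vec m, MemLp f p (volume.restrict (localDomain Ω x R)) →
              ∀ (u : Pt n → Vec m) (g : Pt n → Grad m n), IsLocalSol A Ω x R u g f →
                eLpNorm u ∞ (volume.restrict (localDomain Ω x (R / 2))) ≤
                  ENNReal.ofReal C *
                    (ENNReal.ofReal (R ^ (-(n : ℝ) / 2)) *
                        eLpNorm u 2 (volume.restrict (localDomain Ω x R)) +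
                      ENNReal.ofReal (R ^ (2 - (n : ℝ) * (p⁻¹).toReal)) *
                        eLpNorm f p (volume.restrict (localDomain Ω x R))) := by
    intro p hp
    obtain ⟨C, hC, h⟩ := exists_ae_norm_le hn m hν hμ₀ hN₁ hp
    refine ⟨C, hC, fun A Ω Rmax hA hΩ _ _ hLH x _ R hR hRmax f hf u g hsol => ?_⟩
    obtain ⟨hW, hweak, hv⟩ := hsol
    -- (LH) is symmetric in `L` and `ᵗL`, and the adjoint coefficients are elliptic with the same
    -- `ν`, so both cases share one constant.
    have hae := hweak.elim
      (fun hw => h A A Ω Rmax hA (Or.inl rfl) hΩ hLH x R hR hRmax f u g hf hW hw hv)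
      (fun hw => h A (adj A) Ω Rmax hA.adj (Or.inr rfl) hΩ hLH x R hR hRmax f u g hf hW hw hv)
    rw [eLpNorm_exponent_top]
    refine (eLpNormEssSup_le_of_ae_bound hae).trans (le_of_eq ?_)
    rw [ENNReal.ofReal_mul hC.le, ENNReal.ofReal_add (mul_nonneg (by positivity) lpNorm_nonneg)
        (mul_nonneg (by positivity) lpNorm_nonneg), ENNReal.ofReal_mul (by positivity),
      ENNReal.ofReal_mul (by positivity), ofReal_lpNorm hW.2.1, ofReal_lpNorm hf]
  refine ⟨first, ?_⟩
  -- (LB) is the case `p = ∞`, where `R^(2 - n/p)` becomes `R²`.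
  obtain ⟨C, hC, h⟩ := first ⊤ (by finiteness)
  refine ⟨C, hC, fun A Ω Rmax hA hΩ hΩc hRm hLH x hx R hR hRmax f hf u g hsol => ?_⟩
  simpa using h A Ω Rmax hA hΩ hΩc hRm hLH x hx R hR hRmax f hf u g hsol
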